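/- All algebras are associative over $\mathbb C$, not necessarily unital, with non-degenerate product. $M(A)$ is the multiplier algebra of $A$, with identity $1$, and $\iota$ is the identity map. A comultiplication on $A$ is a linear map $\Delta:A\to M(A\otimes A)$ (not assumed multiplicative) such that $\Delta(a)(1\otimes b)$ and $(a\otimes 1)\Delta(b)$ lie in $A\otimes A$ and $(a\otimes1\otimes1)(\Delta\otimes\iota)(\Delta(b)(1\otimes c))=(\iota\otimes\Delta)((a\otimes1)\Delta(b))(1\otimes1\otimes c)$ for all $a,b,c\in A$; it is regular if also $\Delta(a)(b\otimes1)$ and $(1\otimes a)\Delta(b)$ lie in $A\otimes A$. An algebraic quantum hypergroup is an algebra $A$ with a regular comultiplication $\Delta$, for which there are a counit (a homomorphism $\varepsilon:A\to\mathbb C$ with $(\varepsilon\otimes\iota)\Delta(a)=a=(\iota\otimes\varepsilon)\Delta(a)$), a non-zero faithful left integral (a functional $\varphi$ with $(\iota\otimes\varphi)\Delta(a)=\varphi(a)1$; faithful: $\varphi(ab)=0$ for all $b$, or $\varphi(ba)=0$ for all $b$, implies $a=0$), and an antipode relative to $\varphi$ (a linear bijection $S:A\to A$ with $S(ab)=S(b)S(a)$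 and $S((\iota\otimes\varphi)(\Delta(a)(1\otimes b)))=(\iota\otimes\varphi)((1\otimes a)\Delta(b))$). Slices of $\Delta(a)$ are taken in $M(A)$. Let $(A,\Delta)$ be an algebraic quantum hypergroup with $\varepsilon,\varphi,S$ as above, and put $\psi=\varphi\circ S$. Let $\widehat A=\{\varphi(\,\cdot\,a):a\in A\}$ be the dual algebra, with product $(\omega\omega')(x)=(\omega\otimes\omega')\Delta(x)$. For $\omega\in\widehat A$, $a\in A$ put $\omega\blacktriangleright a=(\iota\otimes\omega)\Delta(a)$ and $a\blacktriangleleft\omega=(\omega\otimes\iota)\Delta(a)$; both lie in $A$. **Proposition 4.3.** The following data exist: * an invertible $\delta\in M(A)$ with $(\varphi\otimes\iota)\Delta(a)=\varphi(a)\delta$ for all $a$, and automorphisms $\sigma,\sigma'$ of $A$ with $\varphi(ab)=\varphi(b\sigma(a))$ and $\psi(ab)=\psi(b\sigma'(a))$ for all $a,b$; * a linear map $\widehat\Delta:\widehat A\to M(\widehat A\otimes\widehat A)$ such that, for all $\omega,\omega'\in\widehat A$, $(\omega\otimes1)\widehat\Delta(\omega')$ and $\widehat\Delta(\omega)(1\otimes\omega')$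 lie in $\widehat A\otimes\widehat A$ with $\langle(\omega\otimes1)\widehat\Delta(\omega'),x\otimes y\rangle=\langle\omega\otimes\omega',\Delta(x)(1\otimes y)\rangle$ and $\langle\widehat\Delta(\omega)(1\otimes\omega'),x\otimes y\rangle=\langle\omega\otimes\omega',(x\otimes1)\Delta(y)\rangle$ for all $x,y\in A$; a linear functional $\widehat\varphi$ on $\widehat A$ with $\widehat\varphi(\omega)=\varepsilon(a)$ whenever $\omega=\psi(a\,\cdot\,)\in\widehat A$, $a\in A$; and an invertible $\widehat\delta\in M(\widehat A)$ with $(\widehat\varphi\otimes\iota)\widehat\Delta(\omega)=\widehat\varphi(\omega)\widehat\delta$ for all $\omega\in\widehat A$. For all such data and all $a\in A$, $$\sigma(a)=\widehat\delta^{-1}\blacktriangleright S^2(a),\qquad \sigma'(a)=S^{-2}(a)\blacktriangleleft\widehat\delta^{-1},$$ $$S^4(a)=\delta^{-1}\bigl((\widehat\delta\blacktriangleright a)\blacktriangleleft\widehat\delta^{-1}\bigr)\delta .$$ Here the actions are extended to $m\in M(\widehat A)$ by $m\blacktriangleright a=(m\omega)\blacktriangleright a$ for a chosen $\omega\in\widehat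 A$ with $\omega\blacktriangleright a=a$, and $a\blacktriangleleft m=a\blacktriangleleft(\omega m)$ for a chosen $\omega\in\widehat A$ with $a\blacktriangleleft\omega=a$ (with the convention that the value is $0$ if no such $\omega$ exists). -/

import Mathlib

open scoped TensorProduct

set_option linter.unusedSectionVars false

noncomputable section

/-! ## Multiplier algebras of (non-unital) complex algebras -/

section MultiplierAlgebra

variable (A : Type*) [NonUnitalRing A] [Module ℂ A] [IsScalarTower ℂ A A] [SMulCommClass ℂ A A]

/-- The product of `A` is non-degenerate. -/
def NondegMul : Prop :=
  (∀ a : A, (∀ b, a * b = 0) → a = 0) ∧ ∀ a : A, (∀ b, b * a = 0) → a = 0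

/-- The multiplier algebra `M(A)`: all pairs `(L, R)` of a left multiplier `L` (thought of as
`a ↦ m a`) and a right multiplier `R` (thought of as `a ↦ a m`) such that
`a (m b) = (a m) b`. The product is `(L, R) (L', R') = (L ∘ L', R' ∘ R)`. -/
def multiplierAlgebra : Subalgebra ℂ (Module.End ℂ A × (Module.End ℂ A)ᵐᵒᵖ) where
  carrier := {m | (∀ a b, m.1 (a * b) = m.1 a * b) ∧
    (∀ a b, m.2.unop (a * b) = a * m.2.unop b) ∧ ∀ a b, a * m.1 b = m.2.unop a * b}
  mul_mem' := by
    rintro m n ⟨h1, h2, h3⟩ ⟨k1, k2, k3⟩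
    refine ⟨fun a b => ?_, fun a b => ?_, fun a b => ?_⟩
    · simp [k1, h1]
    · simp [k2, h2]
    · simp [h3, k3]
  add_mem' := by
    rintro m n ⟨h1, h2, h3⟩ ⟨k1, k2, k3⟩
    refine ⟨fun a b => ?_, fun a b => ?_, fun a b => ?_⟩
    · simp [k1, h1, add_mul]
    · simp [k2, h2, mul_add]
    · simp [h3, k3, add_mul, mul_add]
  algebraMap_mem' := by
    intro r
    refine ⟨fun a b => ?_, fun a b => ?_, fun a b => ?_⟩
    · simp [Algebra.algebraMap_eq_smul_one, smul_mul_assoc]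
    · simp [Algebra.algebraMap_eq_smul_one, mul_smul_comm]
    · simp [Algebra.algebraMap_eq_smul_one, smul_mul_assoc, mul_smul_comm]

/-- The multiplier algebra as a type; it is a unital complex algebra. -/
abbrev Mult : Type _ := multiplierAlgebra A

variable {A}

namespace Mult

/-- `m.lmul a` is the element `m a` of `A`. -/
def lmul (m : Mult A) : A →ₗ[ℂ] A := m.1.1

/-- `m.rmul a` is the element `a m` of `A`. -/
def rmul (m : Mult A) : A →ₗ[ℂ] A := m.1.2.unop

theorem ext' {m n : Mult A} (h1 : ∀ a, m.lmul a = n.lmul a) (h2 : ∀ a, m.rmul a = n.rmul a) :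
    m = n := by
  apply Subtype.ext
  apply Prod.ext
  · exact LinearMap.ext h1
  · exact MulOpposite.unop_injective (LinearMap.ext h2)

@[simp] theorem lmul_mul (m n : Mult A) (a : A) : (m * n).lmul a = m.lmul (n.lmul a) := rfl

@[simp] theorem rmul_mul (m n : Mult A) (a : A) : (m * n).rmul a = n.rmul (m.rmul a) := rfl

theorem lmul_mul_right (m : Mult A) (a b : A) : m.lmul (a * b) = m.lmul a * b := m.2.1 a b

theorem rmul_mul_left (m : Mult A) (a b : A) : m.rmul (a * b) = a * m.rmul b := m.2.2.1 a b

theorem mul_lmul (m : Mult A) (a b : A) : a * m.lmul b = m.rmul a * b := m.2.2.2 a b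

/-- The canonical map `A → M(A)`, by left and right multiplication. -/
def of (a : A) : Mult A :=
  ⟨(LinearMap.mulLeft ℂ a, MulOpposite.op (LinearMap.mulRight ℂ a)),
    fun _ _ => by simp [mul_assoc], fun _ _ => by simp [mul_assoc],
    fun _ _ => by simp [mul_assoc]⟩

@[simp] theorem of_lmul (a b : A) : (of a).lmul b = a * b := rfl

@[simp] theorem of_rmul (a b : A) : (of a).rmul b = b * a := rfl

theorem mul_of (m : Mult A) (a : A) : m * of a = of (m.lmul a) :=
  ext' (fun b => by simp [lmul_mul_right]) (fun b => by simp [mul_lmul])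

theorem of_mul (m : Mult A) (a : A) : of a * m = of (m.rmul a) :=
  ext' (fun b => by simp [mul_lmul]) (fun b => by simp [rmul_mul_left])

theorem of_injective (h : ∀ a : A, (∀ b, a * b = 0) → a = 0) :
    Function.Injective (of : A → Mult A) := by
  intro a b hab
  rw [← sub_eq_zero]
  refine h _ fun c => ?_
  have := congrArg (fun m => lmul m c) hab
  simpa [sub_mul, sub_eq_zero] using this

/-- The element `m ⊗ n` of `M(A ⊗ A)`, for `m` and `n` in `M(A)`. -/
def tmul (m n : Mult A) : Mult (A ⊗[ℂ] A) :=
  ⟨(TensorProduct.map m.lmul n.lmul, MulOpposite.op (TensorProduct.map m.rmul n.rmul)), by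
    refine ⟨fun s t => ?_, fun s t => ?_, fun s t => ?_⟩ <;>
    · induction s with
      | zero => simp
      | add x y hx hy => simp only [add_mul, map_add, hx, hy]
      | tmul p q =>
        induction t with
        | zero => simp
        | add x y hx hy => simp only [mul_add, map_add, hx, hy]
        | tmul r s => simp [lmul_mul_right, rmul_mul_left, mul_lmul]⟩

@[simp] theorem tmul_lmul (m n : Mult A) (t : A ⊗[ℂ] A) :
    (tmul m n).lmul t = TensorProduct.map m.lmul n.lmul t := rfl

@[simp] theorem tmul_rmul (m n : Mult A) (t : A ⊗[ℂ] A) :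
    (tmul m n).rmul t = TensorProduct.map m.rmul n.rmul t := rfl

/-- The multiplier `a ⊗ 1`. -/
def leg1 (a : A) : Mult (A ⊗[ℂ] A) := tmul (of a) 1

/-- The multiplier `1 ⊗ a`. -/
def leg2 (a : A) : Mult (A ⊗[ℂ] A) := tmul 1 (of a)

end Mult

/-- The slice map `f ⊗ ι : A ⊗ A → A`. -/
def sliceL (f : Module.Dual ℂ A) : A ⊗[ℂ] A →ₗ[ℂ] A :=
  (TensorProduct.lid ℂ A).toLinearMap ∘ₗ f.rTensor A

/-- The slice map `ι ⊗ f : A ⊗ A → A`. -/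
def sliceR (f : Module.Dual ℂ A) : A ⊗[ℂ] A →ₗ[ℂ] A :=
  (TensorProduct.rid ℂ A).toLinearMap ∘ₗ f.lTensor A

@[simp] theorem sliceL_tmul (f : Module.Dual ℂ A) (a b : A) : sliceL f (a ⊗ₜ b) = f a • b := by
  simp [sliceL]

@[simp] theorem sliceR_tmul (f : Module.Dual ℂ A) (a b : A) : sliceR f (a ⊗ₜ b) = f b • a := by
  simp [sliceR]

/-- For `m ∈ M(A ⊗ A)` and `n ∈ M(A)`: the slice `(f ⊗ ι) m` is defined in `M(A)` and equals `n`.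
This means that `m (1 ⊗ b)` and `(1 ⊗ b) m` belong to `A ⊗ A`, with `(f ⊗ ι)(m (1 ⊗ b)) = n b` and
`(f ⊗ ι)((1 ⊗ b) m) = b n`, for all `b`. -/
def HasSliceL (f : Module.Dual ℂ A) (m : Mult (A ⊗[ℂ] A)) (n : Mult A) : Prop :=
  (∀ b : A, ∃ t : A ⊗[ℂ] A, Mult.of t = m * Mult.leg2 b ∧ sliceL f t = n.lmul b) ∧
  ∀ b : A, ∃ t : A ⊗[ℂ] A, Mult.of t = Mult.leg2 b * m ∧ sliceL f t = n.rmul b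

/-- For `m ∈ M(A ⊗ A)` and `n ∈ M(A)`: the slice `(ι ⊗ f) m` is defined in `M(A)` and equals `n`.
-/
def HasSliceR (f : Module.Dual ℂ A) (m : Mult (A ⊗[ℂ] A)) (n : Mult A) : Prop :=
  (∀ b : A, ∃ t : A ⊗[ℂ] A, Mult.of t = m * Mult.leg1 b ∧ sliceR f t = n.lmul b) ∧
  ∀ b : A, ∃ t : A ⊗[ℂ] A, Mult.of t = Mult.leg1 b * m ∧ sliceR f t = n.rmul b

end MultiplierAlgebra

/-! ## Algebraic quantum hypergroups -/

/-- An algebraic quantum hypergroup `(A, Δ)`, together with its counit `ε`, a faithful left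
integral `φ` and the antipode `S` relative to `φ`.

The maps `Δr1`, `Δr2`, `Δl1`, `Δl2` are determined by `Δ`: they express that the four products
`Δ(a)(b ⊗ 1)`, `Δ(a)(1 ⊗ b)`, `(a ⊗ 1)Δ(b)` and `(1 ⊗ a)Δ(b)` in `M(A ⊗ A)` lie in `A ⊗ A`.
The comultiplication `Δ` is not assumed to be multiplicative. -/
structure AlgQuantumHypergroup (A : Type*) [NonUnitalRing A] [Module ℂ A] [IsScalarTower ℂ A A]
    [SMulCommClass ℂ A A] where
  nondeg : NondegMul A
  /-- the comultiplication -/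
  Δ : A →ₗ[ℂ] Mult (A ⊗[ℂ] A)
  /-- `Δr1 a b = Δ(a)(b ⊗ 1)` -/
  Δr1 : A →ₗ[ℂ] A →ₗ[ℂ] A ⊗[ℂ] A
  /-- `Δr2 a b = Δ(a)(1 ⊗ b)` -/
  Δr2 : A →ₗ[ℂ] A →ₗ[ℂ] A ⊗[ℂ] A
  /-- `Δl1 a b = (a ⊗ 1)Δ(b)` -/
  Δl1 : A →ₗ[ℂ] A →ₗ[ℂ] A ⊗[ℂ] A
  /-- `Δl2 a b = (1 ⊗ a)Δ(b)` -/
  Δl2 : A →ₗ[ℂ] A →ₗ[ℂ] A ⊗[ℂ] A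
  Δr1_spec : ∀ a b, Mult.of (Δr1 a b) = Δ a * Mult.leg1 b
  Δr2_spec : ∀ a b, Mult.of (Δr2 a b) = Δ a * Mult.leg2 b
  Δl1_spec : ∀ a b, Mult.of (Δl1 a b) = Mult.leg1 a * Δ b
  Δl2_spec : ∀ a b, Mult.of (Δl2 a b) = Mult.leg2 a * Δ b
  /-- coassociativity:
  `(a ⊗ 1 ⊗ 1)(Δ ⊗ ι)(Δ(b)(1 ⊗ c)) = (ι ⊗ Δ)((a ⊗ 1)Δ(b))(1 ⊗ 1 ⊗ c)` -/
  coassoc : ∀ a b c, TensorProduct.assoc ℂ A A A ((Δl1 a).rTensor A (Δr2 b c)) =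
    (Δr2.flip c).lTensor A (Δl1 a b)
  /-- the counit -/
  ε : A →ₗ[ℂ] ℂ
  ε_mul : ∀ a b, ε (a * b) = ε a * ε b
  ε_left : ∀ a, HasSliceL ε (Δ a) (Mult.of a)
  ε_right : ∀ a, HasSliceR ε (Δ a) (Mult.of a)
  /-- the left integral -/
  φ : A →ₗ[ℂ] ℂ
  φ_ne_zero : φ ≠ 0
  φ_invariant : ∀ a, HasSliceR φ (Δ a) (φ a • 1)
  φ_faithful_left : ∀ a, (∀ b, φ (a * b) = 0) → a = 0
  φ_faithful_right : ∀ a, (∀ b, φ (b * a) = 0) → a = 0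
  /-- the antipode -/
  S : A ≃ₗ[ℂ] A
  S_mul : ∀ a b, S (a * b) = S b * S a
  /-- `S((ι ⊗ φ)(Δ(a)(1 ⊗ b))) = (ι ⊗ φ)((1 ⊗ a)Δ(b))` -/
  S_spec : ∀ a b, S (sliceR φ (Δr2 a b)) = sliceR φ (Δl2 a b)

namespace AlgQuantumHypergroup

variable {A : Type*} [NonUnitalRing A] [Module ℂ A] [IsScalarTower ℂ A A] [SMulCommClass ℂ A A]
  (H : AlgQuantumHypergroup A)

/-- The right integral `ψ = φ ∘ S`. -/
def ψ : A →ₗ[ℂ] ℂ := H.φ ∘ₗ H.S.toLinearMap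

/-- The modular element and the modular automorphisms of `(A, Δ)`:
the invertible `δ ∈ M(A)` with `(φ ⊗ ι)Δ(a) = φ(a)δ`, and the automorphisms `σ`, `σ'` of `A` with
`φ(ab) = φ(b σ(a))` and `ψ(ab) = ψ(b σ'(a))`. -/
structure ModularData where
  δ : (Mult A)ˣ
  δ_spec : ∀ a, HasSliceL H.φ (H.Δ a) (H.φ a • (δ : Mult A))
  σ : A ≃ₗ[ℂ] A
  σ_mul : ∀ a b, σ (a * b) = σ a * σ b
  σ_spec : ∀ a b, H.φ (a * b) = H.φ (b * σ a)
  σ' : A ≃ₗ[ℂ] A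
  σ'_mul : ∀ a b, σ' (a * b) = σ' a * σ' b
  σ'_spec : ∀ a b, H.ψ (a * b) = H.ψ (b * σ' a)

/-! ### The dual algebra -/

/-- The linear map `a ↦ φ(· a)` from `A` to its linear dual. -/
def toDual : A →ₗ[ℂ] Module.Dual ℂ A :=
  (LinearMap.mul ℂ A).flip.compr₂ H.φ

@[simp] theorem toDual_apply (a x : A) : H.toDual a x = H.φ (x * a) := rfl

theorem toDual_injective : Function.Injective H.toDual := by
  rw [← LinearMap.ker_eq_bot, LinearMap.ker_eq_bot']
  intro a ha
  exact H.φ_faithful_right a fun b => by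
    have := congrArg (fun f => f b) ha
    simpa using this

/-- The dual `Â`: the space of all functionals `φ(· a)` on `A`, with `a ∈ A`. -/
def Hat : Submodule ℂ (Module.Dual ℂ A) := LinearMap.range H.toDual

/-- The linear isomorphism `a ↦ φ(· a)` from `A` onto `Â`. -/
def hatEquiv : A ≃ₗ[ℂ] H.Hat := LinearEquiv.ofInjective H.toDual H.toDual_injective

theorem hatEquiv_coe (a : A) : (H.hatEquiv a : Module.Dual ℂ A) = H.toDual a := rfl

theorem hat_apply (ω : H.Hat) (x : A) :
    (ω : Module.Dual ℂ A) x = H.φ (x * H.hatEquiv.symm ω) := by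
  conv_lhs => rw [← H.hatEquiv.apply_symm_apply ω]
  rfl

/-- `ω ▷ a = (ι ⊗ ω)Δ(a)`. For `ω = φ(· c)` this is `(ι ⊗ φ)(Δ(a)(1 ⊗ c))`, an element of `A`. -/
def actL : H.Hat →ₗ[ℂ] A →ₗ[ℂ] A :=
  (H.Δr2.compr₂ (sliceR H.φ)).flip ∘ₗ H.hatEquiv.symm.toLinearMap

/-- `a ◁ ω = (ω ⊗ ι)Δ(a)`. For `ω = φ(· c)` this is `(φ ⊗ ι)(Δ(a)(c ⊗ 1))`, an element of `A`. -/
def actR : H.Hat →ₗ[ℂ] A →ₗ[ℂ] A :=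
  (H.Δr1.compr₂ (sliceL H.φ)).flip ∘ₗ H.hatEquiv.symm.toLinearMap

theorem actL_apply (ω : H.Hat) (a : A) :
    H.actL ω a = sliceR H.φ (H.Δr2 a (H.hatEquiv.symm ω)) := rfl

theorem actR_apply (ω : H.Hat) (a : A) :
    H.actR ω a = sliceL H.φ (H.Δr1 a (H.hatEquiv.symm ω)) := rfl

/-- The tensor square has a non-degenerate product. -/
theorem tensor_nondeg (H : AlgQuantumHypergroup A) (t : A ⊗[ℂ] A) (h : ∀ s, t * s = 0) : t = 0 := by
  let ℬ := Module.Free.chooseBasis ℂ A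
  have h1 : ∀ b : A, sliceL (H.toDual b) t = 0 := by
    intro b
    refine H.nondeg.1 _ fun c => ?_
    have h2 : ∀ t : A ⊗[ℂ] A,
        sliceL (H.toDual b) t * c = sliceL H.φ (t * (b ⊗ₜ c)) := by
      intro t
      induction t using TensorProduct.induction_on with
      | zero => simp
      | add x y hx hy => simp only [add_mul, map_add, hx, hy]
      | tmul p q => simp [smul_mul_assoc]
    rw [h2, h, map_zero]
  apply (TensorProduct.equivFinsuppOfBasisRight ℬ).injective
  rw [map_zero]
  ext i
  refine H.φ_faithful_left _ fun b => ?_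
  have h3 : H.φ (TensorProduct.equivFinsuppOfBasisRight ℬ t i * b) =
      ℬ.repr (sliceL (H.toDual b) t) i := by
    clear h h1
    induction t using TensorProduct.induction_on with
    | zero => simp
    | add x y hx hy => simp_all [add_mul]
    | tmul p q => simp [smul_mul_assoc, mul_comm]
  rw [h3, h1]
  simp

theorem tensor_of_injective (H : AlgQuantumHypergroup A) :
    Function.Injective (Mult.of : A ⊗[ℂ] A → Mult (A ⊗[ℂ] A)) :=
  Mult.of_injective H.tensor_nondeg

theorem leg1_comm_leg2 (m n : A) : Mult.leg1 m * Mult.leg2 n = Mult.leg2 n * Mult.leg1 m := by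
  apply Mult.ext' <;> intro t <;>
  · induction t with
    | zero => simp
    | add x y hx hy => simp only [map_add, hx, hy]
    | tmul p q => rfl

theorem leg1_Δl2 (d x a : A) :
    (Mult.leg1 d).lmul (H.Δl2 x a) = (Mult.leg2 x).lmul (H.Δl1 d a) := by
  apply H.tensor_of_injective
  rw [← Mult.mul_of, ← Mult.mul_of, H.Δl2_spec, H.Δl1_spec, ← mul_assoc, ← mul_assoc,
    leg1_comm_leg2]

theorem leg1_Δr2 (d x a : A) :
    (Mult.leg1 d).lmul (H.Δr2 x a) = (Mult.leg2 a).rmul (H.Δl1 d x) := by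
  apply H.tensor_of_injective
  rw [← Mult.mul_of, ← Mult.of_mul, H.Δr2_spec, H.Δl1_spec, mul_assoc]

/-- `ω ▷ a` represents the slice `(ι ⊗ ω)Δ(a)`: one has `d (ω ▷ a) = (ι ⊗ ω)((d ⊗ 1)Δ(a))`. -/
theorem mul_actL (ω : H.Hat) (d a : A) :
    d * H.actL ω a = sliceR (ω : Module.Dual ℂ A) (H.Δl1 d a) := by
  have h1 : ∀ t : A ⊗[ℂ] A, d * sliceR H.φ t = sliceR H.φ ((Mult.leg1 d).lmul t) := by
    intro t
    induction t with
    | zero => simp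
    | add x y hx hy => simp only [map_add, mul_add, hx, hy]
    | tmul p q =>
      change _ = sliceR H.φ ((d * p) ⊗ₜ q)
      simp [mul_smul_comm]
  have h2 : ∀ t : A ⊗[ℂ] A, sliceR H.φ ((Mult.leg2 (H.hatEquiv.symm ω)).rmul t) =
      sliceR (ω : Module.Dual ℂ A) t := by
    intro t
    induction t with
    | zero => simp
    | add x y hx hy => simp only [map_add, hx, hy]
    | tmul p q =>
      change sliceR H.φ (p ⊗ₜ (q * H.hatEquiv.symm ω)) = _
      simp [hat_apply]
  rw [actL_apply, h1, leg1_Δr2, h2]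

/-- The product `ω ω' = (ω ⊗ ω')Δ(·) = ω((ι ⊗ ω')Δ(·))` of two elements of `Â` lies in `Â`. -/
theorem mul_mem_hat (ω ω' : H.Hat) : (ω : Module.Dual ℂ A) ∘ₗ H.actL ω' ∈ H.Hat := by
  set c := H.hatEquiv.symm ω with hc
  set a := H.hatEquiv.symm ω' with ha
  set g : Module.Dual ℂ A := H.φ ∘ₗ H.S.symm.toLinearMap with hg
  refine ⟨sliceL g (H.Δl1 (H.S c) a), LinearMap.ext fun x => ?_⟩
  have h1 : ∀ t : A ⊗[ℂ] A, x * sliceL g t = sliceL g ((Mult.leg2 x).lmul t) := by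
    intro t
    induction t with
    | zero => simp
    | add x y hx hy => simp only [map_add, mul_add, hx, hy]
    | tmul p q =>
      change _ = sliceL g (p ⊗ₜ (x * q))
      simp [mul_smul_comm]
  have h2 : ∀ t : A ⊗[ℂ] A, H.φ (sliceL g ((Mult.leg1 (H.S c)).lmul t)) =
      g (H.S c * sliceR H.φ t) := by
    intro t
    induction t with
    | zero => simp
    | add x y hx hy => simp only [map_add, mul_add, hx, hy]
    | tmul p q =>
      change H.φ (sliceL g ((H.S c * p) ⊗ₜ q)) = _
      simp [mul_smul_comm, mul_comm]
  rw [toDual_apply, h1, ← leg1_Δl2, h2, ← H.S_spec, ← H.S_mul, LinearMap.comp_apply,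
    LinearMap.comp_apply, hat_apply, actL_apply]
  simp [hc, ha]

instance : Mul H.Hat := ⟨fun ω ω' => ⟨(ω : Module.Dual ℂ A) ∘ₗ H.actL ω', H.mul_mem_hat ω ω'⟩⟩

/-- The product of `Â` is dual to the comultiplication of `A`. -/
theorem hat_mul_apply (ω ω' : H.Hat) (x : A) :
    ((ω * ω' : H.Hat) : Module.Dual ℂ A) x = (ω : Module.Dual ℂ A) (H.actL ω' x) := rfl

theorem actL_mul (ω ω' : H.Hat) (x : A) : H.actL (ω * ω') x = H.actL ω (H.actL ω' x) := by
  rw [← sub_eq_zero]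
  refine H.nondeg.2 _ fun d => ?_
  rw [mul_sub, sub_eq_zero, mul_actL, mul_actL]
  set c := H.hatEquiv.symm ω' with hc
  have h1 : sliceR (ω : Module.Dual ℂ A) (H.Δl1 d (H.actL ω' x)) =
      sliceR H.φ ((sliceR (ω : Module.Dual ℂ A) ∘ₗ H.Δl1 d).rTensor A (H.Δr2 x c)) := by
    rw [actL_apply, ← hc]
    induction H.Δr2 x c with
    | zero => simp
    | add x y hx hy => simp only [map_add, hx, hy]
    | tmul p q => simp
  have h2 : ∀ t : (A ⊗[ℂ] A) ⊗[ℂ] A, (sliceR (ω : Module.Dual ℂ A)).rTensor A t =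
      (sliceL (ω : Module.Dual ℂ A)).lTensor A (TensorProduct.assoc ℂ A A A t) := by
    intro t
    induction t with
    | zero => simp
    | add x y hx hy => simp only [map_add, hx, hy]
    | tmul s r =>
      induction s with
      | zero => simp
      | add x y hx hy => simp only [map_add, TensorProduct.add_tmul, hx, hy]
      | tmul p q => simp [TensorProduct.smul_tmul]
  have h3 : ∀ t : A ⊗[ℂ] A, sliceR ((ω * ω' : H.Hat) : Module.Dual ℂ A) t =
      sliceR H.φ ((sliceL (ω : Module.Dual ℂ A) ∘ₗ H.Δr2.flip c).lTensor A t) := by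
    intro t
    induction t with
    | zero => simp
    | add x y hx hy => simp only [map_add, hx, hy]
    | tmul p q =>
      have h4 : ∀ s : A ⊗[ℂ] A, (ω : Module.Dual ℂ A) (sliceR H.φ s) =
          H.φ (sliceL (ω : Module.Dual ℂ A) s) := by
        intro s
        induction s with
        | zero => simp
        | add x y hx hy => simp only [map_add, hx, hy]
        | tmul p q => simp [mul_comm]
      simp [hat_mul_apply, actL_apply, h4, ← hc]
  rw [h1, h3, LinearMap.rTensor_comp, LinearMap.lTensor_comp, LinearMap.comp_apply,
    LinearMap.comp_apply, h2, H.coassoc]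

/-- The dual algebra `Â`. -/
instance : NonUnitalRing H.Hat where
  left_distrib ω ω' ω'' := Subtype.ext <| LinearMap.ext fun x => by
    simp [hat_mul_apply]
  right_distrib ω ω' ω'' := Subtype.ext <| LinearMap.ext fun x => by
    simp [hat_mul_apply]
  zero_mul ω := Subtype.ext <| LinearMap.ext fun x => by
    simp [hat_mul_apply]
  mul_zero ω := Subtype.ext <| LinearMap.ext fun x => by
    simp [hat_mul_apply]
  mul_assoc ω ω' ω'' := Subtype.ext <| LinearMap.ext fun x => by
    simp [hat_mul_apply, actL_mul]

instance : IsScalarTower ℂ H.Hat H.Hat where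
  smul_assoc r ω ω' := Subtype.ext <| LinearMap.ext fun x => by
    simp [hat_mul_apply]

instance : SMulCommClass ℂ H.Hat H.Hat where
  smul_comm r ω ω' := Subtype.ext <| LinearMap.ext fun x => by
    simp [hat_mul_apply]

/-! ### The comultiplication, the left integral and the modular element of the dual -/

/-- The functional on `A ⊗ A` given by an element of `Â ⊗ Â`. -/
def hatPair : H.Hat ⊗[ℂ] H.Hat →ₗ[ℂ] Module.Dual ℂ (A ⊗[ℂ] A) :=
  TensorProduct.dualDistrib ℂ A A ∘ₗ TensorProduct.map H.Hat.subtype H.Hat.subtype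

@[simp] theorem hatPair_tmul (ω ω' : H.Hat) (x y : A) :
    H.hatPair (ω ⊗ₜ ω') (x ⊗ₜ y) = (ω : Module.Dual ℂ A) x * (ω' : Module.Dual ℂ A) y := rfl

/-- The structure of the dual `Â` that enters the definition of its modular element:
* the comultiplication `Δ̂ : Â → M(Â ⊗ Â)`, given by
  `⟨(ω ⊗ 1)Δ̂(ω'), x ⊗ y⟩ = ⟨ω ⊗ ω', Δ(x)(1 ⊗ y)⟩` and
  `⟨Δ̂(ω)(1 ⊗ ω'), x ⊗ y⟩ = ⟨ω ⊗ ω', (x ⊗ 1)Δ(y)⟩`, these products being in `Â ⊗ Â`;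
* the left integral `φ̂` on `Â`, given by `φ̂(ψ(a ·)) = ε(a)`;
* the modular element of `(Â, Δ̂)`, i.e. the invertible `δ̂ ∈ M(Â)` with
  `(φ̂ ⊗ ι)Δ̂(ω) = φ̂(ω)δ̂`. -/
structure DualData where
  Δ : H.Hat →ₗ[ℂ] Mult (H.Hat ⊗[ℂ] H.Hat)
  Δ_left : ∀ ω ω' : H.Hat, ∃ t, Mult.of t = Mult.leg1 ω * Δ ω' ∧
    ∀ x y, H.hatPair t (x ⊗ₜ y) = H.hatPair (ω ⊗ₜ ω') (H.Δr2 x y)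
  Δ_right : ∀ ω ω' : H.Hat, ∃ t, Mult.of t = Δ ω * Mult.leg2 ω' ∧
    ∀ x y, H.hatPair t (x ⊗ₜ y) = H.hatPair (ω ⊗ₜ ω') (H.Δl1 x y)
  φ : H.Hat →ₗ[ℂ] ℂ
  φ_spec : ∀ (a : A) (ω : H.Hat), (∀ x, (ω : Module.Dual ℂ A) x = H.ψ (a * x)) → φ ω = H.ε a
  δ : (Mult H.Hat)ˣ
  δ_spec : ∀ ω, HasSliceL φ (Δ ω) (φ ω • (δ : Mult H.Hat))

/-! ### The actions of `M(Â)` on `A` -/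

open Classical in
/-- The extension of the left action `▷` to `M(Â)`: `m ▷ a = (m ω) ▷ a`, where `ω ∈ Â` is chosen
such that `ω ▷ a = a`. (The value for elements `a` without such an `ω` is set to `0`; in fact there
are none.) -/
def multActL (m : Mult H.Hat) (a : A) : A :=
  if h : ∃ ω : H.Hat, H.actL ω a = a then H.actL (m.lmul h.choose) a else 0

open Classical in
/-- The extension of the right action `◁` to `M(Â)`: `a ◁ m = a ◁ (ω m)`, where `ω ∈ Â` is chosen
such that `a ◁ ω = a`. (The value for elements `a` without such an `ω` is set to `0`; in fact there
are none.) -/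
def multActR (a : A) (m : Mult H.Hat) : A :=
  if h : ∃ ω : H.Hat, H.actR ω a = a then H.actR (m.rmul h.choose) a else 0

end AlgQuantumHypergroup

end

/-! The whole statement reduces to one functional, the character `χ = ε ∘ σ⁻¹`: the modular element
of the dual is `χ`, acting as a multiplier of `Â`.

On `A`, the antipode formula and the modular property together give `Δ(σ(a)) = (S² ⊗ σ)Δ(a)` and
`Δ(σ'(a)) = (σ' ⊗ S⁻²)Δ(a)` (`S_S_sliceR_φ`, `S_S_sliceL_ψ`). Moreover `σ'(a)δ = δσ(a)`, so `ε ∘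
σ'⁻¹ = χ` as well (`χ_σ'`). Applying `χ` to the leg carrying `σ` or `σ'` yields `χ ▷ σ(a) = S²(a)`
and `σ'(a) ◁ χ = S⁻²(a)` (`χ_actR_σ`, `χ_actL_σ'`).

On the dual, `φ̂(φ(· zc)) = χ(z) φ̂(φ(· c))` (`dualφ_hatEquiv_mul`). Since `Δ̂(ω)` is the functional
`x ⊗ y ↦ ω(xy)`, slicing it with `φ̂` produces `φ̂(ω)χ`. Hence `δ̂ = χ` (`dualData_lmul`,
`dualData_rmul`), and the first two formulas follow by inverting. For the third, `(δ̂ ▷ σ(a)) ◁ δ̂⁻¹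
= S²(a) ◁ δ̂⁻¹ = σ'(S⁴(a))`; conjugation by `δ` turns this into `σ(S⁴(a))`, and `σ` commutes with
`S²` because `φ ∘ S²` is a multiple of `φ` (`σ_S_S`).

Existence rests on three facts: elements of `A` are recovered from slices of their own
comultiplication, `Δ ∘ S` is the flip of `(S ⊗ S)Δ`, and the functionals `φ(· u)`, `ψ(· v)` and `ψ(v
·)` fill out the same space. -/

noncomputable section

/-! ### Slice maps on the tensor square -/

section Slices

variable {A : Type*} [NonUnitalRing A] [Module ℂ A] [IsScalarTower ℂ A A] [SMulCommClass ℂ A A]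

open Mult

@[simp] theorem Mult.leg1_lmul_tmul (d p q : A) :
    (leg1 d).lmul (p ⊗ₜ[ℂ] q) = (d * p) ⊗ₜ q := rfl

@[simp] theorem Mult.leg1_rmul_tmul (d p q : A) :
    (leg1 d).rmul (p ⊗ₜ[ℂ] q) = (p * d) ⊗ₜ q := rfl

@[simp] theorem Mult.leg2_lmul_tmul (d p q : A) :
    (leg2 d).lmul (p ⊗ₜ[ℂ] q) = p ⊗ₜ (d * q) := rfl

@[simp] theorem Mult.leg2_rmul_tmul (d p q : A) :
    (leg2 d).rmul (p ⊗ₜ[ℂ] q) = p ⊗ₜ (q * d) := rfl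

theorem Mult.leg1_mul (a b : A) : leg1 (a * b) = leg1 a * leg1 b := by
  apply Mult.ext' <;> intro t <;>
  · induction t with
    | zero => simp
    | add x y hx hy => simp only [map_add, hx, hy]
    | tmul p q => simp [mul_assoc]

theorem Mult.leg2_mul (a b : A) : leg2 (a * b) = leg2 a * leg2 b := by
  apply Mult.ext' <;> intro t <;>
  · induction t with
    | zero => simp
    | add x y hx hy => simp only [map_add, hx, hy]
    | tmul p q => simp [mul_assoc]

variable (f g : Module.Dual ℂ A) (d : A) (t : A ⊗[ℂ] A)

theorem sliceL_leg1_lmul : sliceL f ((leg1 d).lmul t) = sliceL (f ∘ₗ LinearMap.mulLeft ℂ d) t := by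
  induction t with
  | zero => simp
  | add x y hx hy => simp only [map_add, hx, hy]
  | tmul p q => simp

theorem sliceR_leg2_lmul : sliceR f ((leg2 d).lmul t) = sliceR (f ∘ₗ LinearMap.mulLeft ℂ d) t := by
  induction t with
  | zero => simp
  | add x y hx hy => simp only [map_add, hx, hy]
  | tmul p q => simp

theorem sliceR_leg2_rmul : sliceR f ((leg2 d).rmul t) = sliceR (f ∘ₗ LinearMap.mulRight ℂ d) t := by
  induction t with
  | zero => simp
  | add x y hx hy => simp only [map_add, hx, hy]
  | tmul p q => simp

theorem sliceL_leg2_lmul : sliceL f ((leg2 d).lmul t) = d * sliceL f t := by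
  induction t with
  | zero => simp
  | add x y hx hy => simp only [map_add, mul_add, hx, hy]
  | tmul p q => simp [mul_smul_comm]

theorem sliceL_leg2_rmul : sliceL f ((leg2 d).rmul t) = sliceL f t * d := by
  induction t with
  | zero => simp
  | add x y hx hy => simp only [map_add, add_mul, hx, hy]
  | tmul p q => simp [smul_mul_assoc]

theorem sliceR_leg1_lmul : sliceR f ((leg1 d).lmul t) = d * sliceR f t := by
  induction t with
  | zero => simp
  | add x y hx hy => simp only [map_add, mul_add, hx, hy]
  | tmul p q => simp [mul_smul_comm]

theorem sliceR_leg1_rmul : sliceR f ((leg1 d).rmul t) = sliceR f t * d := by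
  induction t with
  | zero => simp
  | add x y hx hy => simp only [map_add, add_mul, hx, hy]
  | tmul p q => simp [smul_mul_assoc]

theorem apply_sliceR : g (sliceR f t) = f (sliceL g t) := by
  induction t with
  | zero => simp
  | add x y hx hy => simp only [map_add, hx, hy]
  | tmul p q => simp [mul_comm]

theorem sliceL_comm : sliceL f (TensorProduct.comm ℂ A A t) = sliceR f t := by
  induction t with
  | zero => simp
  | add x y hx hy => simp only [map_add, hx, hy]
  | tmul p q => simp

theorem sliceR_rTensor (T : A →ₗ[ℂ] A) : sliceR f (T.rTensor A t) = T (sliceR f t) := by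
  induction t with
  | zero => simp
  | add x y hx hy => simp only [map_add, hx, hy]
  | tmul p q => simp

theorem leg2_lmul_rTensor (T : A →ₗ[ℂ] A) :
    (leg2 d).lmul (T.rTensor A t) = T.rTensor A ((leg2 d).lmul t) := by
  induction t with
  | zero => simp
  | add x y hx hy => simp only [map_add, hx, hy]
  | tmul p q => simp

theorem leg2_rmul_rTensor (T : A →ₗ[ℂ] A) :
    (leg2 d).rmul (T.rTensor A t) = T.rTensor A ((leg2 d).rmul t) := by
  induction t with
  | zero => simp
  | add x y hx hy => simp only [map_add, hx, hy]
  | tmul p q => simp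

variable {t}

/-- A tensor is determined by its slices with a separating family of functionals. -/
theorem eq_zero_of_sliceL {ι : Type*} (F : ι → Module.Dual ℂ A)
    (hF : ∀ a, (∀ i, F i a = 0) → a = 0) (h : ∀ i, sliceL (F i) t = 0) : t = 0 := by
  let ℬ := Module.Free.chooseBasis ℂ A
  apply (TensorProduct.equivFinsuppOfBasisRight ℬ).injective
  rw [map_zero]
  ext k
  refine hF _ fun i => ?_
  have h3 : F i (TensorProduct.equivFinsuppOfBasisRight ℬ t k) = ℬ.repr (sliceL (F i) t) k := by
    clear h
    induction t using TensorProduct.induction_on with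
    | zero => simp
    | add x y hx hy => simp_all
    | tmul p q => simp [mul_comm]
  rw [h3, h]
  simp

theorem eq_zero_of_sliceR {ι : Type*} (F : ι → Module.Dual ℂ A)
    (hF : ∀ a, (∀ i, F i a = 0) → a = 0) (h : ∀ i, sliceR (F i) t = 0) : t = 0 := by
  have : TensorProduct.comm ℂ A A t = 0 :=
    eq_zero_of_sliceL F hF fun i => by rw [sliceL_comm, h]
  simpa using this

end Slices

namespace AlgQuantumHypergroup

variable {A : Type*} [NonUnitalRing A] [Module ℂ A] [IsScalarTower ℂ A A] [SMulCommClass ℂ A A]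
  (H : AlgQuantumHypergroup A)

open Mult

/-! ### Multiplying `Δ(a)` on both legs -/

theorem leg1_rmul_Δl2 (d x a : A) : (leg1 d).rmul (H.Δl2 x a) = (leg2 x).lmul (H.Δr1 a d) := by
  apply H.tensor_of_injective
  rw [← mul_of, ← of_mul, H.Δl2_spec, H.Δr1_spec, mul_assoc]

theorem leg1_rmul_Δr2 (d x a : A) : (leg1 d).rmul (H.Δr2 a x) = (leg2 x).rmul (H.Δr1 a d) := by
  apply H.tensor_of_injective
  rw [← of_mul, ← of_mul, H.Δr2_spec, H.Δr1_spec, mul_assoc, mul_assoc, leg1_comm_leg2]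

theorem leg2_rmul_Δl2 (d x a : A) : (leg2 d).rmul (H.Δl2 x a) = (leg2 x).lmul (H.Δr2 a d) := by
  apply H.tensor_of_injective
  rw [← of_mul, ← mul_of, H.Δl2_spec, H.Δr2_spec, mul_assoc]

theorem Δr1_mul (a b c : A) : H.Δr1 a (b * c) = (leg1 c).rmul (H.Δr1 a b) := by
  apply H.tensor_of_injective
  rw [← of_mul, H.Δr1_spec, H.Δr1_spec, leg1_mul, mul_assoc]

theorem Δr2_mul (a b c : A) : H.Δr2 a (b * c) = (leg2 c).rmul (H.Δr2 a b) := by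
  apply H.tensor_of_injective
  rw [← of_mul, H.Δr2_spec, H.Δr2_spec, leg2_mul, mul_assoc]

theorem Δl1_mul (a b c : A) : H.Δl1 (b * c) a = (leg1 b).lmul (H.Δl1 c a) := by
  apply H.tensor_of_injective
  rw [← mul_of, H.Δl1_spec, H.Δl1_spec, leg1_mul, mul_assoc]

theorem Δl2_mul (a b c : A) : H.Δl2 (b * c) a = (leg2 b).lmul (H.Δl2 c a) := by
  apply H.tensor_of_injective
  rw [← mul_of, H.Δl2_spec, H.Δl2_spec, leg2_mul, mul_assoc]

/-! ### Exchanging slices on the two legs of `Δ(a)` -/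

section Fubini

variable (f g : Module.Dual ℂ A) (a c d : A)

/-- Both sides are `g ⊗ f` evaluated at `(d ⊗ 1)Δ(a)(1 ⊗ c)`. In the four variants the names record
on which side (`l` or `r`) each leg of `Δ(a)` is multiplied. -/
theorem fubini_l1_r2 :
    g (d * sliceR f (H.Δr2 a c)) = f (sliceL g (H.Δl1 d a) * c) := by
  rw [← sliceR_leg1_lmul, leg1_Δr2, apply_sliceR, sliceL_leg2_rmul]

theorem fubini_r1_r2 :
    g (sliceR f (H.Δr2 a c) * d) = f (sliceL g (H.Δr1 a d) * c) := by
  rw [← sliceR_leg1_rmul, leg1_rmul_Δr2, apply_sliceR, sliceL_leg2_rmul]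

theorem fubini_l1_l2 :
    g (d * sliceR f (H.Δl2 c a)) = f (c * sliceL g (H.Δl1 d a)) := by
  rw [← sliceR_leg1_lmul, leg1_Δl2, apply_sliceR, sliceL_leg2_lmul]

theorem fubini_r1_l2 :
    g (sliceR f (H.Δl2 c a) * d) = f (c * sliceL g (H.Δr1 a d)) := by
  rw [← sliceR_leg1_rmul, leg1_rmul_Δl2, apply_sliceR, sliceL_leg2_lmul]

end Fubini

theorem eq_of_forall_φ_left {a b : A} (h : ∀ c, H.φ (c * a) = H.φ (c * b)) : a = b := by
  rw [← sub_eq_zero]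
  exact H.φ_faithful_right _ fun c => by rw [mul_sub, map_sub, h, sub_self]

theorem eq_of_forall_φ_right {a b : A} (h : ∀ c, H.φ (a * c) = H.φ (b * c)) : a = b := by
  rw [← sub_eq_zero]
  exact H.φ_faithful_left _ fun c => by rw [sub_mul, map_sub, h, sub_self]

theorem eq_of_forall_leg2_rmul (H : AlgQuantumHypergroup A) {s t : A ⊗[ℂ] A} (h : ∀ e, (leg2 e).rmul s = (leg2 e).rmul t) :
    s = t := by
  rw [← sub_eq_zero]
  refine eq_zero_of_sliceR (fun e => H.φ ∘ₗ LinearMap.mulRight ℂ e)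
    (fun a ha => H.φ_faithful_left _ ha) fun e => ?_
  rw [← sliceR_leg2_rmul, map_sub, h, sub_self, map_zero]

theorem eq_of_forall_leg1_lmul (H : AlgQuantumHypergroup A) {s t : A ⊗[ℂ] A} (h : ∀ e, (leg1 e).lmul s = (leg1 e).lmul t) :
    s = t := by
  rw [← sub_eq_zero]
  refine eq_zero_of_sliceL (fun e => H.φ ∘ₗ LinearMap.mulLeft ℂ e)
    (fun a ha => H.φ_faithful_right _ ha) fun e => ?_
  rw [← sliceL_leg1_lmul, map_sub, h, sub_self, map_zero]

/-- `Δ` commutes with slicing the first leg. -/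
theorem Δr2_sliceL_Δl1 (g : Module.Dual ℂ A) (d a c : A) :
    H.Δr2 (sliceL g (H.Δl1 d a)) c = (sliceL g ∘ₗ H.Δl1 d).rTensor A (H.Δr2 a c) := by
  have h1 : ∀ t : (A ⊗[ℂ] A) ⊗[ℂ] A, (sliceL g).rTensor A t =
      ((TensorProduct.lid ℂ (A ⊗[ℂ] A)).toLinearMap ∘ₗ g.rTensor (A ⊗[ℂ] A))
        (TensorProduct.assoc ℂ A A A t) := by
    intro t
    induction t with
    | zero => simp
    | add x y hx hy => simp only [map_add, hx, hy]
    | tmul s r =>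
      induction s with
      | zero => simp
      | add x y hx hy => simp only [map_add, TensorProduct.add_tmul, hx, hy]
      | tmul p q => simp [TensorProduct.smul_tmul']
  rw [LinearMap.rTensor_comp, LinearMap.comp_apply, h1, H.coassoc]
  induction H.Δl1 d a with
  | zero => simp
  | add x y hx hy => simp only [map_add, LinearMap.add_apply, hx, hy]
  | tmul p q => simp

theorem Δl2_sliceL_Δl1 (g : Module.Dual ℂ A) (d a c : A) :
    H.Δl2 c (sliceL g (H.Δl1 d a)) = (sliceL g ∘ₗ H.Δl1 d).rTensor A (H.Δl2 c a) := by
  refine H.eq_of_forall_leg2_rmul fun e => ?_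
  rw [leg2_rmul_Δl2, Δr2_sliceL_Δl1, leg2_rmul_rTensor, leg2_lmul_rTensor, leg2_rmul_Δl2]

theorem sliceL_Δl1_sliceR_Δr2 (f g : Module.Dual ℂ A) (d a c : A) :
    sliceL g (H.Δl1 d (sliceR f (H.Δr2 a c))) = sliceR f (H.Δr2 (sliceL g (H.Δl1 d a)) c) := by
  rw [Δr2_sliceL_Δl1, sliceR_rTensor, LinearMap.comp_apply]

theorem sliceL_Δl1_sliceR_Δl2 (f g : Module.Dual ℂ A) (d a c : A) :
    sliceL g (H.Δl1 d (sliceR f (H.Δl2 c a))) = sliceR f (H.Δl2 c (sliceL g (H.Δl1 d a))) := by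
  rw [Δl2_sliceL_Δl1, sliceR_rTensor, LinearMap.comp_apply]

/-! ### Slices in the multiplier algebra -/

theorem hasSliceL_iff (f : Module.Dual ℂ A) (a : A) (n : Mult A) :
    HasSliceL f (H.Δ a) n ↔ (∀ b, sliceL f (H.Δr2 a b) = n.lmul b) ∧
      ∀ b, sliceL f (H.Δl2 b a) = n.rmul b := by
  constructor
  · rintro ⟨h1, h2⟩
    refine ⟨fun b => ?_, fun b => ?_⟩
    · obtain ⟨t, ht, h⟩ := h1 b
      rw [← h, H.tensor_of_injective (ht.trans (H.Δr2_spec a b).symm)]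
    · obtain ⟨t, ht, h⟩ := h2 b
      rw [← h, H.tensor_of_injective (ht.trans (H.Δl2_spec b a).symm)]
  · rintro ⟨h1, h2⟩
    exact ⟨fun b => ⟨_, H.Δr2_spec a b, h1 b⟩, fun b => ⟨_, H.Δl2_spec b a, h2 b⟩⟩

theorem hasSliceR_iff (f : Module.Dual ℂ A) (a : A) (n : Mult A) :
    HasSliceR f (H.Δ a) n ↔ (∀ b, sliceR f (H.Δr1 a b) = n.lmul b) ∧
      ∀ b, sliceR f (H.Δl1 b a) = n.rmul b := by
  constructor
  · rintro ⟨h1, h2⟩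
    refine ⟨fun b => ?_, fun b => ?_⟩
    · obtain ⟨t, ht, h⟩ := h1 b
      rw [← h, H.tensor_of_injective (ht.trans (H.Δr1_spec a b).symm)]
    · obtain ⟨t, ht, h⟩ := h2 b
      rw [← h, H.tensor_of_injective (ht.trans (H.Δl1_spec b a).symm)]
  · rintro ⟨h1, h2⟩
    exact ⟨fun b => ⟨_, H.Δr1_spec a b, h1 b⟩, fun b => ⟨_, H.Δl1_spec b a, h2 b⟩⟩

theorem sliceR_φ_Δr1 (a b : A) : sliceR H.φ (H.Δr1 a b) = H.φ a • b :=
  ((H.hasSliceR_iff _ _ _).1 (H.φ_invariant a)).1 b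

theorem sliceR_φ_Δl1 (a b : A) : sliceR H.φ (H.Δl1 b a) = H.φ a • b :=
  ((H.hasSliceR_iff _ _ _).1 (H.φ_invariant a)).2 b

theorem sliceR_ε_Δr1 (a b : A) : sliceR H.ε (H.Δr1 a b) = a * b :=
  ((H.hasSliceR_iff _ _ _).1 (H.ε_right a)).1 b

theorem sliceR_ε_Δl1 (a b : A) : sliceR H.ε (H.Δl1 b a) = b * a :=
  ((H.hasSliceR_iff _ _ _).1 (H.ε_right a)).2 b

theorem sliceL_ε_Δr2 (a b : A) : sliceL H.ε (H.Δr2 a b) = a * b :=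
  ((H.hasSliceL_iff _ _ _).1 (H.ε_left a)).1 b

theorem sliceL_ε_Δl2 (a b : A) : sliceL H.ε (H.Δl2 b a) = b * a :=
  ((H.hasSliceL_iff _ _ _).1 (H.ε_left a)).2 b

theorem sliceR_comp_mulRight_ε (c : A) (t : A ⊗[ℂ] A) :
    sliceR H.ε ((leg2 c).rmul t) = H.ε c • sliceR H.ε t := by
  induction t with
  | zero => simp
  | add x y hx hy => simp only [map_add, smul_add, hx, hy]
  | tmul p q => simp [H.ε_mul, smul_smul, mul_comm]

theorem sliceR_comp_mulLeft_ε (c : A) (t : A ⊗[ℂ] A) :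
    sliceR H.ε ((leg2 c).lmul t) = H.ε c • sliceR H.ε t := by
  induction t with
  | zero => simp
  | add x y hx hy => simp only [map_add, smul_add, hx, hy]
  | tmul p q => simp [H.ε_mul, smul_smul]

theorem sliceL_comp_mulRight_ε (c : A) (t : A ⊗[ℂ] A) :
    sliceL H.ε ((leg1 c).rmul t) = H.ε c • sliceL H.ε t := by
  induction t with
  | zero => simp
  | add x y hx hy => simp only [map_add, smul_add, hx, hy]
  | tmul p q => simp [H.ε_mul, smul_smul, mul_comm]

theorem sliceL_comp_mulLeft_ε (c : A) (t : A ⊗[ℂ] A) :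
    sliceL H.ε ((leg1 c).lmul t) = H.ε c • sliceL H.ε t := by
  induction t with
  | zero => simp
  | add x y hx hy => simp only [map_add, smul_add, hx, hy]
  | tmul p q => simp [H.ε_mul, smul_smul]

/-- The counit axiom multiplies on the leg that survives the slice. Here the factor sits on the leg
that is sliced away, and multiplicativity of `ε` extracts it as the scalar `ε(c)`. -/
theorem sliceR_ε_Δr2 (a c : A) : sliceR H.ε (H.Δr2 a c) = H.ε c • a := by
  refine H.eq_of_forall_φ_left fun b => ?_
  rw [← sliceR_leg1_lmul, leg1_Δr2, sliceR_comp_mulRight_ε, sliceR_ε_Δl1, mul_smul_comm]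

theorem sliceR_ε_Δl2 (a c : A) : sliceR H.ε (H.Δl2 c a) = H.ε c • a := by
  refine H.eq_of_forall_φ_left fun b => ?_
  rw [← sliceR_leg1_lmul, leg1_Δl2, sliceR_comp_mulLeft_ε, sliceR_ε_Δl1, mul_smul_comm]

theorem sliceL_ε_Δr1 (a c : A) : sliceL H.ε (H.Δr1 a c) = H.ε c • a := by
  refine H.eq_of_forall_φ_left fun b => ?_
  rw [← sliceL_leg2_lmul, ← leg1_rmul_Δl2, sliceL_comp_mulRight_ε, sliceL_ε_Δl2, mul_smul_comm]

theorem sliceL_ε_Δl1 (a c : A) : sliceL H.ε (H.Δl1 c a) = H.ε c • a := by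
  refine H.eq_of_forall_φ_left fun b => ?_
  rw [← sliceL_leg2_lmul, ← leg1_Δl2, sliceL_comp_mulLeft_ε, sliceL_ε_Δl2, mul_smul_comm]

theorem ε_ne_zero : H.ε ≠ 0 := by
  intro h
  apply H.φ_ne_zero
  ext a
  have : a = 0 := H.nondeg.1 _ fun b => by rw [← sliceL_ε_Δr2, h]; simp [sliceL]
  simp [this]

theorem exists_ε_eq_one : ∃ e, H.ε e = 1 := by
  obtain ⟨a, ha⟩ : ∃ a, H.ε a ≠ 0 := by
    by_contra! h
    exact H.ε_ne_zero (LinearMap.ext h)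
  exact ⟨(H.ε a)⁻¹ • a, by simp [ha]⟩

end AlgQuantumHypergroup

/-- A vector outside a subspace is detected by a functional vanishing on that subspace. The local
units below are all obtained from this criterion. -/
theorem LinearMap.mem_range_of_forall_dual {V W : Type*} [AddCommGroup V] [Module ℂ V]
    [AddCommGroup W] [Module ℂ W] (T : V →ₗ[ℂ] W) (w : W)
    (h : ∀ f : Module.Dual ℂ W, (∀ v, f (T v) = 0) → f w = 0) : ∃ v, T v = w := by
  by_contra hw
  obtain ⟨f, hf, hf'⟩ := Submodule.exists_dual_map_eq_bot_of_notMem (p := LinearMap.range T)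
    (x := w) hw inferInstance
  refine hf (h f fun v => ?_)
  have : f (T v) ∈ (LinearMap.range T).map f := ⟨T v, ⟨v, rfl⟩, rfl⟩
  rw [hf'] at this
  simpa using this

namespace AlgQuantumHypergroup

variable {A : Type*} [NonUnitalRing A] [Module ℂ A] [IsScalarTower ℂ A A] [SMulCommClass ℂ A A]
  (H : AlgQuantumHypergroup A)

open Mult

/-! ### Local units -/

/-- A functional is faithful if both associated bilinear forms are non-degenerate. -/
def Faithful (f : Module.Dual ℂ A) : Prop :=
  (∀ a, (∀ b, f (a * b) = 0) → a = 0) ∧ ∀ a, (∀ b, f (b * a) = 0) → a = 0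

theorem faithful_φ : Faithful H.φ := ⟨H.φ_faithful_left, H.φ_faithful_right⟩

theorem Faithful.comp_antiEquiv {f : Module.Dual ℂ A} (hf : Faithful f) (T : A ≃ₗ[ℂ] A)
    (hT : ∀ a b, T (a * b) = T b * T a) : Faithful (f ∘ₗ T.toLinearMap) := by
  constructor
  · intro a h
    have : T a = 0 := hf.2 _ fun b => by simpa [hT] using h (T.symm b)
    simpa using this
  · intro a h
    have : T a = 0 := hf.1 _ fun b => by simpa [hT] using h (T.symm b)
    simpa using this

theorem S_symm_mul (a b : A) : H.S.symm (a * b) = H.S.symm b * H.S.symm a := by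
  apply H.S.injective
  simp [H.S_mul]

/-- The right integral `φ ∘ S⁻¹`. -/
def κ : Module.Dual ℂ A := H.φ ∘ₗ H.S.symm.toLinearMap

theorem faithful_ψ : Faithful H.ψ := H.faithful_φ.comp_antiEquiv H.S H.S_mul

theorem faithful_κ : Faithful H.κ := H.faithful_φ.comp_antiEquiv H.S.symm H.S_symm_mul

/-- If `g` kills all these slices, then `(g ⊗ ι)(Δ(a)(1 ⊗ e))` is annihilated by every `f(· c)`,
hence vanishes by faithfulness. Applying `ε` with `ε(e) = 1` leaves `g(a) = 0`. The three companions
differ only in legs and sides. -/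
theorem exists_sliceR_Δr2_eq {f : Module.Dual ℂ A} (hf : Faithful f) (a : A) :
    ∃ c, sliceR f (H.Δr2 a c) = a := by
  refine LinearMap.mem_range_of_forall_dual (sliceR f ∘ₗ H.Δr2 a) a fun g hg => ?_
  obtain ⟨e, he⟩ := H.exists_ε_eq_one
  have : sliceL g (H.Δr2 a e) = 0 := hf.1 _ fun c => by
    rw [← sliceL_leg2_rmul, ← Δr2_mul, ← apply_sliceR]
    exact hg _
  have := congrArg H.ε this
  rwa [← apply_sliceR, sliceR_ε_Δr2, he, one_smul, map_zero] at this

theorem exists_sliceR_Δl2_eq {f : Module.Dual ℂ A} (hf : Faithful f) (a : A) :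
    ∃ c, sliceR f (H.Δl2 c a) = a := by
  refine LinearMap.mem_range_of_forall_dual (sliceR f ∘ₗ H.Δl2.flip a) a fun g hg => ?_
  obtain ⟨e, he⟩ := H.exists_ε_eq_one
  have : sliceL g (H.Δl2 e a) = 0 := hf.2 _ fun c => by
    rw [← sliceL_leg2_lmul, ← Δl2_mul, ← apply_sliceR]
    exact hg _
  have := congrArg H.ε this
  rwa [← apply_sliceR, sliceR_ε_Δl2, he, one_smul, map_zero] at this

theorem exists_sliceL_Δr1_eq {f : Module.Dual ℂ A} (hf : Faithful f) (a : A) :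
    ∃ c, sliceL f (H.Δr1 a c) = a := by
  refine LinearMap.mem_range_of_forall_dual (sliceL f ∘ₗ H.Δr1 a) a fun g hg => ?_
  obtain ⟨e, he⟩ := H.exists_ε_eq_one
  have : sliceR g (H.Δr1 a e) = 0 := hf.1 _ fun c => by
    rw [← sliceR_leg1_rmul, ← Δr1_mul, apply_sliceR]
    exact hg _
  have := congrArg H.ε this
  rwa [apply_sliceR, sliceL_ε_Δr1, he, one_smul, map_zero] at this

theorem exists_sliceL_Δl1_eq {f : Module.Dual ℂ A} (hf : Faithful f) (a : A) :
    ∃ c, sliceL f (H.Δl1 c a) = a := by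
  refine LinearMap.mem_range_of_forall_dual (sliceL f ∘ₗ H.Δl1.flip a) a fun g hg => ?_
  obtain ⟨e, he⟩ := H.exists_ε_eq_one
  have : sliceR g (H.Δl1 e a) = 0 := hf.2 _ fun c => by
    rw [← sliceR_leg1_lmul, ← Δl1_mul, apply_sliceR]
    exact hg _
  have := congrArg H.ε this
  rwa [apply_sliceR, sliceL_ε_Δl1, he, one_smul, map_zero] at this

theorem S_symm_sliceR_Δl2 (a b : A) :
    H.S.symm (sliceR H.φ (H.Δl2 a b)) = sliceR H.φ (H.Δr2 a b) := by
  rw [← H.S_spec, LinearEquiv.symm_apply_apply]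

theorem exists_φ_eq_one : ∃ e, H.φ e = 1 := by
  obtain ⟨a, ha⟩ : ∃ a, H.φ a ≠ 0 := by
    by_contra! h
    exact H.φ_ne_zero (LinearMap.ext h)
  exact ⟨(H.φ a)⁻¹ • a, by simp [ha]⟩

/-- Let `f` vanish on `aA`. The antipode formula shows that `(f ∘ S⁻¹ ⊗ ι)(Δ(e)(S(a) ⊗ 1))` is
orthogonal to everything under `φ`, so it is zero; left invariance then gives `f(a)φ(e) = 0`. -/
theorem exists_mul_right_eq (H : AlgQuantumHypergroup A) (a : A) : ∃ b, a * b = a := by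
  refine LinearMap.mem_range_of_forall_dual (LinearMap.mulLeft ℂ a) a fun f hf => ?_
  simp only [LinearMap.mulLeft_apply] at hf
  obtain ⟨e, he⟩ := H.exists_φ_eq_one
  have h1 : sliceL (f ∘ₗ H.S.symm.toLinearMap) (H.Δr1 e (H.S a)) = 0 :=
    H.φ_faithful_right _ fun p => by
      rw [← fubini_r1_l2, ← H.S_spec, ← H.S_mul]
      simpa using hf _
  have := congrArg H.φ h1
  rw [← apply_sliceR, sliceR_φ_Δr1, he] at this
  simpa using this

end AlgQuantumHypergroup

/-! ### Equality and invertibility of multipliers -/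

section MultExt

variable {A : Type*} [NonUnitalRing A] [Module ℂ A] [IsScalarTower ℂ A A] [SMulCommClass ℂ A A]

theorem Mult.ext_rmul (h : ∀ a : A, (∀ b, b * a = 0) → a = 0) {m n : Mult A}
    (hmn : ∀ a, m.rmul a = n.rmul a) : m = n := by
  refine Mult.ext' (fun a => ?_) hmn
  rw [← sub_eq_zero]
  refine h _ fun b => ?_
  rw [mul_sub, Mult.mul_lmul, Mult.mul_lmul, hmn, sub_self]

theorem Mult.ext_lmul (h : ∀ a : A, (∀ b, a * b = 0) → a = 0) {m n : Mult A}
    (hmn : ∀ a, m.lmul a = n.lmul a) : m = n := by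
  refine Mult.ext' hmn (fun a => ?_)
  rw [← sub_eq_zero]
  refine h _ fun b => ?_
  rw [sub_mul, ← Mult.mul_lmul, ← Mult.mul_lmul, hmn, sub_self]

/-- A multiplier acting bijectively from both sides is invertible. -/
theorem Mult.isUnit_of_bijective {m : Mult A} (hl : Function.Bijective m.lmul)
    (hr : Function.Bijective m.rmul) : IsUnit m := by
  let l := LinearEquiv.ofBijective m.lmul hl
  let r := LinearEquiv.ofBijective m.rmul hr
  have l_apply : ∀ a, m.lmul (l.symm a) = a := l.apply_symm_apply
  have r_apply : ∀ a, m.rmul (r.symm a) = a := r.apply_symm_apply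
  let n : Mult A := ⟨(l.symm.toLinearMap, MulOpposite.op r.symm.toLinearMap), by
    refine ⟨fun a b => hl.1 ?_, fun a b => hr.1 ?_, fun a b => ?_⟩
    · simp [lmul_mul_right, l_apply]
    · simp [rmul_mul_left, r_apply]
    · change a * l.symm b = r.symm a * b
      conv_lhs => rw [← r_apply a]
      rw [← mul_lmul, l_apply]⟩
  refine ⟨⟨m, n, ?_, ?_⟩, rfl⟩
  · exact Mult.ext' (fun a => l_apply a) (fun a => r.symm_apply_apply a)
  · exact Mult.ext' (fun a => l.symm_apply_apply a) (fun a => r_apply a)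

@[simp] theorem Mult.lmul_inv_apply (u : (Mult A)ˣ) (a : A) :
    (u : Mult A).lmul ((↑u⁻¹ : Mult A).lmul a) = a := by
  rw [← lmul_mul, Units.mul_inv]; rfl

@[simp] theorem Mult.lmul_apply_inv (u : (Mult A)ˣ) (a : A) :
    (↑u⁻¹ : Mult A).lmul ((u : Mult A).lmul a) = a := by
  rw [← lmul_mul, Units.inv_mul]; rfl

@[simp] theorem Mult.rmul_inv_apply (u : (Mult A)ˣ) (a : A) :
    (u : Mult A).rmul ((↑u⁻¹ : Mult A).rmul a) = a := by
  rw [← rmul_mul, Units.inv_mul]; rfl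

@[simp] theorem Mult.rmul_apply_inv (u : (Mult A)ˣ) (a : A) :
    (↑u⁻¹ : Mult A).rmul ((u : Mult A).rmul a) = a := by
  rw [← rmul_mul, Units.mul_inv]; rfl

end MultExt

namespace AlgQuantumHypergroup

variable {A : Type*} [NonUnitalRing A] [Module ℂ A] [IsScalarTower ℂ A A] [SMulCommClass ℂ A A]
  (H : AlgQuantumHypergroup A)

open Mult

theorem eq_of_forall_leg2_lmul (H : AlgQuantumHypergroup A) {s t : A ⊗[ℂ] A}
    (h : ∀ e, (leg2 e).lmul s = (leg2 e).lmul t) : s = t := by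
  rw [← sub_eq_zero]
  refine eq_zero_of_sliceR (fun e => H.φ ∘ₗ LinearMap.mulLeft ℂ e)
    (fun a ha => H.φ_faithful_right _ ha) fun e => ?_
  rw [← sliceR_leg2_lmul, map_sub, h, sub_self, map_zero]

theorem leg1_lmul_leg2_lmul (a b : A) (t : A ⊗[ℂ] A) :
    (leg1 a).lmul ((leg2 b).lmul t) = (a ⊗ₜ b) * t := by
  induction t with
  | zero => simp
  | add x y hx hy => simp only [map_add, mul_add, hx, hy]
  | tmul p q => simp

theorem tensor_nondeg_right (H : AlgQuantumHypergroup A) (t : A ⊗[ℂ] A) (h : ∀ s, s * t = 0) :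
    t = 0 := by
  refine H.eq_of_forall_leg2_lmul fun b => H.eq_of_forall_leg1_lmul fun a => ?_
  rw [leg1_lmul_leg2_lmul, h, map_zero, map_zero]

/-- A right local unit `p e = p` absorbs the factor `e ⊗ 1`, so each `m` is determined on `p ⊗ q` by
`(e ⊗ 1)m`. -/
theorem leg1_mul_cancel (H : AlgQuantumHypergroup A) {m n : Mult (A ⊗[ℂ] A)}
    (h : ∀ a, leg1 a * m = leg1 a * n) : m = n := by
  refine Mult.ext_rmul H.tensor_nondeg_right fun t => ?_
  induction t with
  | zero => simp
  | add x y hx hy => simp only [map_add, hx, hy]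
  | tmul p q =>
    obtain ⟨e, he⟩ := H.exists_mul_right_eq p
    have := congrArg (fun k => k.rmul (p ⊗ₜ q)) (h e)
    simpa [he] using this

/-! ### The antipode and the comultiplication -/

/-- The map `S ⊗ S` followed by the flip. -/
def flipS : A ⊗[ℂ] A ≃ₗ[ℂ] A ⊗[ℂ] A :=
  (TensorProduct.congr H.S H.S).trans (TensorProduct.comm ℂ A A)

@[simp] theorem flipS_tmul (a b : A) : H.flipS (a ⊗ₜ b) = H.S b ⊗ₜ H.S a := rfl

theorem flipS_mul (s t : A ⊗[ℂ] A) : H.flipS (s * t) = H.flipS t * H.flipS s := by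
  induction s with
  | zero => simp
  | add x y hx hy => simp only [add_mul, mul_add, map_add, hx, hy]
  | tmul p q =>
    induction t with
    | zero => simp
    | add x y hx hy => simp only [add_mul, mul_add, map_add, hx, hy]
    | tmul p q => simp [H.S_mul]

theorem flipS_symm_mul (s t : A ⊗[ℂ] A) :
    H.flipS.symm (s * t) = H.flipS.symm t * H.flipS.symm s := by
  apply H.flipS.injective
  simp [flipS_mul]

theorem sliceL_flipS (f : Module.Dual ℂ A) (t : A ⊗[ℂ] A) :
    sliceL f (H.flipS t) = H.S (sliceR (f ∘ₗ H.S.toLinearMap) t) := by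
  induction t with
  | zero => simp
  | add x y hx hy => simp only [map_add, hx, hy]
  | tmul p q => simp

theorem sliceR_flipS (f : Module.Dual ℂ A) (t : A ⊗[ℂ] A) :
    sliceR f (H.flipS t) = H.S (sliceL (f ∘ₗ H.S.toLinearMap) t) := by
  induction t with
  | zero => simp
  | add x y hx hy => simp only [map_add, hx, hy]
  | tmul p q => simp

theorem leg1_lmul_flipS (e : A) (t : A ⊗[ℂ] A) :
    (leg1 (H.S e)).lmul (H.flipS t) = H.flipS ((leg2 e).rmul t) := by
  induction t with
  | zero => simp
  | add x y hx hy => simp only [map_add, hx, hy]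
  | tmul p q => simp [H.S_mul]

/-- The extension of `flipS` to an anti-automorphism of `M(A ⊗ A)`. -/
def multFlipS (m : Mult (A ⊗[ℂ] A)) : Mult (A ⊗[ℂ] A) :=
  ⟨(H.flipS.toLinearMap ∘ₗ m.rmul ∘ₗ H.flipS.symm.toLinearMap,
    MulOpposite.op (H.flipS.toLinearMap ∘ₗ m.lmul ∘ₗ H.flipS.symm.toLinearMap)), by
    refine ⟨fun a b => ?_, fun a b => ?_, fun a b => ?_⟩
    · simp [flipS_symm_mul, flipS_mul, rmul_mul_left]
    · simp [flipS_symm_mul, flipS_mul, lmul_mul_right]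
    · apply H.flipS.symm.injective
      simp [flipS_symm_mul, mul_lmul]⟩

theorem multFlipS_lmul (m : Mult (A ⊗[ℂ] A)) (t : A ⊗[ℂ] A) :
    (H.multFlipS m).lmul t = H.flipS (m.rmul (H.flipS.symm t)) := rfl

theorem multFlipS_rmul (m : Mult (A ⊗[ℂ] A)) (t : A ⊗[ℂ] A) :
    (H.multFlipS m).rmul t = H.flipS (m.lmul (H.flipS.symm t)) := rfl

theorem multFlipS_mul (m n : Mult (A ⊗[ℂ] A)) :
    H.multFlipS (m * n) = H.multFlipS n * H.multFlipS m :=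
  Mult.ext' (fun t => by simp [multFlipS_lmul]) (fun t => by simp [multFlipS_rmul])

theorem multFlipS_of (t : A ⊗[ℂ] A) : H.multFlipS (of t) = of (H.flipS t) :=
  Mult.ext' (fun s => by simp [multFlipS_lmul, flipS_mul])
    (fun s => by simp [multFlipS_rmul, flipS_mul])

theorem multFlipS_leg1 (a : A) : H.multFlipS (leg1 a) = leg2 (H.S a) := by
  refine Mult.ext' (fun s => ?_) (fun s => ?_) <;>
  · obtain ⟨s, rfl⟩ := H.flipS.surjective s
    simp only [multFlipS_lmul, multFlipS_rmul, LinearEquiv.symm_apply_apply]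
    induction s with
    | zero => simp
    | add x y hx hy => simp only [map_add, hx, hy]
    | tmul p q => simp [H.S_mul]

theorem multFlipS_leg2 (a : A) : H.multFlipS (leg2 a) = leg1 (H.S a) := by
  refine Mult.ext' (fun s => ?_) (fun s => ?_) <;>
  · obtain ⟨s, rfl⟩ := H.flipS.surjective s
    simp only [multFlipS_lmul, multFlipS_rmul, LinearEquiv.symm_apply_apply]
    induction s with
    | zero => simp
    | add x y hx hy => simp only [map_add, hx, hy]
    | tmul p q => simp [H.S_mul]

/-- This is `Δ ∘ S = flip (S ⊗ S)Δ` with one leg integrated. When `y` is itself a slice, the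
antipode formula expresses `S(y)` as a slice; coassociativity lets slices of opposite outer legs
commute, and a second use of the antipode formula compares the two sides under `φ`. -/
theorem sliceL_φ_Δl1_S (c y : A) :
    sliceL H.φ (H.Δl1 (H.S c) (H.S y)) = H.S (sliceR H.ψ (H.Δr2 y c)) := by
  obtain ⟨x, b, rfl⟩ : ∃ x b, sliceR H.φ (H.Δr2 x b) = y :=
    ⟨y, H.exists_sliceR_Δr2_eq H.faithful_φ y⟩
  rw [H.S_spec, sliceL_Δl1_sliceR_Δl2, ← H.S_spec]
  congr 1
  refine H.eq_of_forall_φ_left fun p => ?_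
  rw [fubini_l1_r2, fubini_l1_r2, sliceL_Δl1_sliceR_Δr2, ← fubini_l1_l2, ← H.S_spec, ψ,
    LinearMap.comp_apply, LinearEquiv.coe_coe, H.S_mul]

/-- Faithfulness of `φ` makes the functionals `φ(S(e) ·)` separating, so the integrated identity
`sliceL_φ_Δl1_S` determines the tensor. -/
theorem Δl1_S (c y : A) : H.Δl1 (H.S c) (H.S y) = H.flipS (H.Δr2 y c) := by
  rw [← sub_eq_zero]
  refine eq_zero_of_sliceL (fun e => H.φ ∘ₗ LinearMap.mulLeft ℂ (H.S e)) (fun a ha => ?_)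
    fun e => ?_
  · exact H.φ_faithful_right _ fun b => by simpa using ha (H.S.symm b)
  · rw [map_sub, ← sliceL_leg1_lmul, ← sliceL_leg1_lmul, ← Δl1_mul, ← H.S_mul, leg1_lmul_flipS,
      sliceL_φ_Δl1_S, sliceL_flipS, Δr2_mul]
    exact sub_self _

/-- The antipode flips the comultiplication. -/
theorem Δ_S (y : A) : H.Δ (H.S y) = H.multFlipS (H.Δ y) := by
  refine H.leg1_mul_cancel fun a => ?_
  obtain ⟨c, rfl⟩ := H.S.surjective a
  rw [← H.Δl1_spec, Δl1_S, ← multFlipS_leg2, ← multFlipS_mul, ← multFlipS_of, H.Δr2_spec]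

theorem Δr1_S (y c : A) : H.Δr1 (H.S y) (H.S c) = H.flipS (H.Δl2 c y) := by
  apply H.tensor_of_injective
  rw [H.Δr1_spec, Δ_S, ← multFlipS_leg2, ← multFlipS_mul, ← H.Δl2_spec, multFlipS_of]

theorem Δr2_S (y c : A) : H.Δr2 (H.S y) (H.S c) = H.flipS (H.Δl1 c y) := by
  apply H.tensor_of_injective
  rw [H.Δr2_spec, Δ_S, ← multFlipS_leg1, ← multFlipS_mul, ← H.Δl1_spec, multFlipS_of]

theorem Δl2_S (c y : A) : H.Δl2 (H.S c) (H.S y) = H.flipS (H.Δr1 y c) := by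
  apply H.tensor_of_injective
  rw [H.Δl2_spec, Δ_S, ← multFlipS_leg1, ← multFlipS_mul, ← H.Δr1_spec, multFlipS_of]

/-- The characterization of the antipode in terms of the right integral. -/
theorem S_sliceL_ψ (a b : A) : H.S (sliceL H.ψ (H.Δl1 b a)) = sliceL H.ψ (H.Δr1 b a) := by
  apply H.S.injective
  have h1 : H.S (sliceL H.ψ (H.Δr1 b a)) = sliceR H.φ (H.Δl2 (H.S a) (H.S b)) := by
    rw [Δl2_S, sliceR_flipS, ψ]
  rw [h1, ← H.S_spec, Δr2_S, sliceR_flipS, ψ]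

/-! ### Integrals -/

/-- Invariance of a functional from the right: `(f ⊗ ι)Δ(a) = f(a)1`. -/
def RightInvariant (f : Module.Dual ℂ A) : Prop :=
  (∀ a b, sliceL f (H.Δr2 a b) = f a • b) ∧ ∀ a b, sliceL f (H.Δl2 b a) = f a • b

/-- Invariance of a functional from the left: `(ι ⊗ f)Δ(a) = f(a)1`. -/
def LeftInvariant (f : Module.Dual ℂ A) : Prop :=
  (∀ a b, sliceR f (H.Δr1 a b) = f a • b) ∧ ∀ a b, sliceR f (H.Δl1 b a) = f a • b

variable {H}

theorem LeftInvariant.comp_S {f : Module.Dual ℂ A} (hf : H.LeftInvariant f) :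
    H.RightInvariant (f ∘ₗ H.S.toLinearMap) := by
  constructor
  · intro a b
    apply H.S.injective
    rw [← sliceR_flipS, ← Δl1_S, hf.2]
    simp
  · intro a b
    apply H.S.injective
    rw [← sliceR_flipS, ← Δr1_S, hf.1]
    simp

theorem RightInvariant.comp_S {f : Module.Dual ℂ A} (hf : H.RightInvariant f) :
    H.LeftInvariant (f ∘ₗ H.S.toLinearMap) := by
  constructor
  · intro a b
    apply H.S.injective
    rw [← sliceL_flipS, ← Δl2_S, hf.2]
    simp
  · intro a b
    apply H.S.injective
    rw [← sliceL_flipS, ← Δr2_S, hf.1]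
    simp

variable (H)

theorem leftInvariant_φ : H.LeftInvariant H.φ := ⟨H.sliceR_φ_Δr1, H.sliceR_φ_Δl1⟩

theorem rightInvariant_ψ : H.RightInvariant H.ψ := H.leftInvariant_φ.comp_S

theorem κ_comp_S : H.κ ∘ₗ H.S.toLinearMap = H.φ := by
  ext a
  simp [κ]

theorem rightInvariant_κ : H.RightInvariant H.κ := by
  constructor
  · intro a b
    obtain ⟨a, rfl⟩ := H.S.surjective a
    obtain ⟨b, rfl⟩ := H.S.surjective b
    rw [Δr2_S, sliceL_flipS, κ_comp_S, sliceR_φ_Δl1]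
    simp [κ]
  · intro a b
    obtain ⟨a, rfl⟩ := H.S.surjective a
    obtain ⟨b, rfl⟩ := H.S.surjective b
    rw [Δl2_S, sliceL_flipS, κ_comp_S, sliceR_φ_Δr1]
    simp [κ]

/-- Integrating the other leg first and applying the antipode formula backwards brings in the right
invariant functional `κ`. The result depends on `a` only through `φ(a)`, which is why a modular
element exists. -/
theorem φ_sliceL_φ_Δr2 (a b : A) : H.φ (sliceL H.φ (H.Δr2 a b)) = H.φ a * H.κ b := by
  rw [← apply_sliceR, ← S_symm_sliceR_Δl2]
  change H.κ _ = _
  rw [apply_sliceR, H.rightInvariant_κ.2]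
  simp [mul_comm]

theorem φ_sliceL_φ_Δl2 (a b : A) : H.φ (sliceL H.φ (H.Δl2 b a)) = H.φ a * H.ψ b := by
  rw [← apply_sliceR, ← H.S_spec]
  change H.ψ _ = _
  rw [apply_sliceR, H.rightInvariant_ψ.1]
  simp [mul_comm]

/-- Left integrals are unique up to a scalar. -/
theorem exists_smul_eq_of_rightInvariant_comp_S (f : Module.Dual ℂ A)
    (hf : H.RightInvariant (f ∘ₗ H.S.toLinearMap)) : ∃ τ : ℂ, ∀ a, f a = τ * H.φ a := by
  have h1 : ∀ a b, H.φ (sliceL f (H.Δl2 a b)) = H.φ b * f (H.S a) := by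
    intro a b
    rw [← apply_sliceR, ← H.S_spec]
    change (f ∘ₗ H.S.toLinearMap) _ = _
    rw [apply_sliceR, hf.1]
    simp [mul_comm]
  have h2 : ∀ b, H.φ b = 0 → f b = 0 := by
    intro b hb
    obtain ⟨e, he⟩ := H.exists_ε_eq_one
    -- By `h1` the pairing of this slice with any `c` carries the factor `φ(b) = 0`. Evaluating the
    -- slice at `ε` returns `f(b)`.
    have : sliceL f (H.Δl2 e b) = 0 := H.φ_faithful_right _ fun c => by
      rw [← sliceL_leg2_lmul, ← Δl2_mul, h1, hb, zero_mul]
    have := congrArg H.ε this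
    rw [← apply_sliceR, sliceR_ε_Δl2, he] at this
    simpa using this
  obtain ⟨e, he⟩ := H.exists_φ_eq_one
  refine ⟨f e, fun a => ?_⟩
  have := h2 (a - H.φ a • e) (by simp [he])
  rw [map_sub, map_smul, sub_eq_zero] at this
  rw [this, smul_eq_mul, mul_comm]

/-- The scaling constant: the left integral is relatively invariant under `S²`. -/
theorem exists_φ_S_S : ∃ τ : ℂ, τ ≠ 0 ∧ ∀ a, H.φ (H.S (H.S a)) = τ * H.φ a := by
  -- Each composition with `S` swaps left and right invariance, so `φ ∘ S³` is right invariant, as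
  -- uniqueness for `φ ∘ S²` requires.
  obtain ⟨τ, hτ⟩ := H.exists_smul_eq_of_rightInvariant_comp_S
    (H.φ ∘ₗ H.S.toLinearMap ∘ₗ H.S.toLinearMap)
    H.rightInvariant_ψ.comp_S.comp_S
  refine ⟨τ, ?_, hτ⟩
  rintro rfl
  obtain ⟨e, he⟩ := H.exists_φ_eq_one
  have := hτ (H.S.symm (H.S.symm e))
  simp [he] at this

end AlgQuantumHypergroup

/-- Two injective linear maps with the same range differ by a linear equivalence. -/
theorem LinearMap.exists_equiv_of_range_eq {V W : Type*} [AddCommGroup V] [Module ℂ V]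
    [AddCommGroup W] [Module ℂ W] {T₁ T₂ : V →ₗ[ℂ] W} (h₁ : Function.Injective T₁)
    (h₂ : Function.Injective T₂) (h₁₂ : ∀ v, ∃ u, T₂ u = T₁ v) (h₂₁ : ∀ u, ∃ v, T₁ v = T₂ u) :
    ∃ e : V ≃ₗ[ℂ] V, ∀ v, T₂ (e v) = T₁ v := by
  have hr : LinearMap.range T₁ = LinearMap.range T₂ := by
    ext w
    constructor
    · rintro ⟨v, rfl⟩
      exact h₁₂ v
    · rintro ⟨u, rfl⟩
      exact h₂₁ u
  refine ⟨(LinearEquiv.ofInjective T₁ h₁).trans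
    ((LinearEquiv.ofEq _ _ hr).trans (LinearEquiv.ofInjective T₂ h₂).symm), fun v => ?_⟩
  have h3 : ∀ w : LinearMap.range T₂, T₂ ((LinearEquiv.ofInjective T₂ h₂).symm w) = w := fun w =>
    congrArg Subtype.val ((LinearEquiv.ofInjective T₂ h₂).apply_symm_apply w)
  simp only [LinearEquiv.trans_apply, h3]
  rfl

namespace AlgQuantumHypergroup

variable {A : Type*} [NonUnitalRing A] [Module ℂ A] [IsScalarTower ℂ A A] [SMulCommClass ℂ A A]
  (H : AlgQuantumHypergroup A)

open Mult

theorem ψ_apply (a : A) : H.ψ a = H.φ (H.S a) := rfl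

theorem κ_apply (a : A) : H.κ a = H.φ (H.S.symm a) := rfl

/-! ### Modular automorphisms -/

/-- Turns a functional with density relative to `φ` into one with density relative to `ψ`. Local
units allow either slice to be any prescribed element, which yields both inclusions in
`exists_equiv_ψ_mul`. -/
theorem φ_mul_sliceL_Δl1 (a b c : A) :
    H.φ (b * sliceL H.φ (H.Δl1 (H.S a) c)) =
      H.ψ (b * sliceR H.ψ (H.Δl2 (H.S.symm c) a)) := by
  rw [← fubini_l1_l2, ← H.S_spec, ← H.S_mul, ← ψ_apply, fubini_r1_r2, ← S_sliceL_ψ, fubini_l1_l2,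
    ψ_apply, H.S_mul, LinearEquiv.apply_symm_apply]

/-- The counterpart with the `ψ`-density on the left of the argument; it serves
`exists_equiv_mul_ψ`. -/
theorem φ_mul_sliceL_Δr1 (a b c : A) :
    H.φ (b * sliceL H.φ (H.Δr1 c (H.S a))) =
      H.ψ (sliceR H.κ (H.Δl2 (H.S c) a) * b) := by
  rw [← fubini_r1_l2, ← H.S_spec, ← H.S_mul, ← ψ_apply, fubini_l1_r2, fubini_r1_l2, ← S_sliceL_ψ,
    κ_apply, ← H.S_mul, LinearEquiv.symm_apply_apply]

theorem exists_equiv_ψ_mul :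
    ∃ α : A ≃ₗ[ℂ] A, ∀ v b, H.φ (b * α v) = H.ψ (b * v) := by
  let T₁ : A →ₗ[ℂ] Module.Dual ℂ A := (LinearMap.mul ℂ A).flip.compr₂ H.ψ
  have h₁ : Function.Injective T₁ := by
    rw [← LinearMap.ker_eq_bot, LinearMap.ker_eq_bot']
    exact fun a ha => H.faithful_ψ.2 _ fun b => congrArg (fun f => f b) ha
  have h₁₂ : ∀ v, ∃ u, H.toDual u = T₁ v := by
    intro v
    obtain ⟨c, hc⟩ := H.exists_sliceR_Δl2_eq H.faithful_ψ v
    refine ⟨sliceL H.φ (H.Δl1 (H.S v) (H.S c)), LinearMap.ext fun b => ?_⟩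
    have := H.φ_mul_sliceL_Δl1 v b (H.S c)
    rw [LinearEquiv.symm_apply_apply, hc] at this
    exact this
  have h₂₁ : ∀ u, ∃ v, T₁ v = H.toDual u := by
    intro u
    obtain ⟨c, hc⟩ := H.exists_sliceL_Δl1_eq H.faithful_φ u
    refine ⟨sliceR H.ψ (H.Δl2 (H.S.symm u) (H.S.symm c)), LinearMap.ext fun b => ?_⟩
    have := H.φ_mul_sliceL_Δl1 (H.S.symm c) b u
    rw [LinearEquiv.apply_symm_apply, hc] at this
    exact this.symm
  obtain ⟨α, hα⟩ := LinearMap.exists_equiv_of_range_eq h₁ H.toDual_injective h₁₂ h₂₁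
  exact ⟨α, fun v b => congrArg (fun f => f b) (hα v)⟩

theorem exists_equiv_mul_ψ :
    ∃ β : A ≃ₗ[ℂ] A, ∀ v b, H.φ (b * β v) = H.ψ (v * b) := by
  let T₁ : A →ₗ[ℂ] Module.Dual ℂ A := (LinearMap.mul ℂ A).compr₂ H.ψ
  have h₁ : Function.Injective T₁ := by
    rw [← LinearMap.ker_eq_bot, LinearMap.ker_eq_bot']
    exact fun a ha => H.faithful_ψ.1 _ fun b => congrArg (fun f => f b) ha
  have h₁₂ : ∀ v, ∃ u, H.toDual u = T₁ v := by
    intro v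
    obtain ⟨c, hc⟩ := H.exists_sliceR_Δl2_eq H.faithful_κ v
    refine ⟨sliceL H.φ (H.Δr1 (H.S.symm c) (H.S v)), LinearMap.ext fun b => ?_⟩
    have := H.φ_mul_sliceL_Δr1 v b (H.S.symm c)
    rw [LinearEquiv.apply_symm_apply, hc] at this
    exact this
  have h₂₁ : ∀ u, ∃ v, T₁ v = H.toDual u := by
    intro u
    obtain ⟨c, hc⟩ := H.exists_sliceL_Δr1_eq H.faithful_φ u
    refine ⟨sliceR H.κ (H.Δl2 (H.S u) (H.S.symm c)), LinearMap.ext fun b => ?_⟩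
    have := H.φ_mul_sliceL_Δr1 (H.S.symm c) b u
    rw [LinearEquiv.apply_symm_apply, hc] at this
    exact this.symm
  obtain ⟨β, hβ⟩ := LinearMap.exists_equiv_of_range_eq h₁ H.toDual_injective h₁₂ h₂₁
  exact ⟨β, fun v b => congrArg (fun f => f b) (hβ v)⟩

theorem Faithful.eq_right {f : Module.Dual ℂ A} (hf : Faithful f) {a b : A}
    (h : ∀ c, f (c * a) = f (c * b)) : a = b := by
  rw [← sub_eq_zero]
  exact hf.2 _ fun c => by rw [mul_sub, map_sub, h, sub_self]

/-- Moving `a` and then `b` cyclically gives `f(c σ(ab)) = f(abc) = f(c σ(a)σ(b))`, so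
multiplicativity is automatic for faithful `f`. -/
theorem map_mul_of_modular {f : Module.Dual ℂ A} (hf : Faithful f) (σ : A → A)
    (hσ : ∀ a b, f (a * b) = f (b * σ a)) (a b : A) : σ (a * b) = σ a * σ b :=
  hf.eq_right fun c => by
    rw [← hσ, mul_assoc, hσ, mul_assoc, hσ, mul_assoc]

/-- The multiplier `(φ ⊗ ι)Δ(e)`. -/
def modularElement (e : A) : Mult A :=
  ⟨(sliceL H.φ ∘ₗ H.Δr2 e, MulOpposite.op (sliceL H.φ ∘ₗ H.Δl2.flip e)), by
    refine ⟨fun a b => ?_, fun a b => ?_, fun a b => ?_⟩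
    · simp [Δr2_mul, sliceL_leg2_rmul]
    · simp [Δl2_mul, sliceL_leg2_lmul]
    · simp [← sliceL_leg2_lmul, ← sliceL_leg2_rmul, leg2_rmul_Δl2]⟩

theorem modularElement_spec (e : A) (he : H.φ e = 1) (a : A) :
    HasSliceL H.φ (H.Δ a) (H.φ a • H.modularElement e) := by
  rw [hasSliceL_iff]
  constructor
  · intro b
    change _ = H.φ a • sliceL H.φ (H.Δr2 e b)
    refine H.eq_of_forall_φ_right fun c => ?_
    rw [smul_mul_assoc, map_smul, ← sliceL_leg2_rmul, ← sliceL_leg2_rmul, ← Δr2_mul, ← Δr2_mul,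
      φ_sliceL_φ_Δr2, φ_sliceL_φ_Δr2, he, one_mul, smul_eq_mul]
  · intro b
    change _ = H.φ a • sliceL H.φ (H.Δl2 b e)
    refine H.eq_of_forall_φ_left fun c => ?_
    rw [mul_smul_comm, map_smul, ← sliceL_leg2_lmul, ← sliceL_leg2_lmul, ← Δl2_mul, ← Δl2_mul,
      φ_sliceL_φ_Δl2, φ_sliceL_φ_Δl2, he, one_mul, smul_eq_mul]

/-- Apply `φ` to `(φ ⊗ ι)((1 ⊗ b)Δ(e)) = bδ`, where `φ(e) = 1`. -/
theorem φ_rmul_of_spec {δ : Mult A} (hδ : ∀ a, HasSliceL H.φ (H.Δ a) (H.φ a • δ)) (b : A) :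
    H.φ (δ.rmul b) = H.ψ b := by
  obtain ⟨e, he⟩ := H.exists_φ_eq_one
  have := ((H.hasSliceL_iff _ _ _).1 (hδ e)).2 b
  rw [he, one_smul] at this
  rw [← this, φ_sliceL_φ_Δl2, he, one_mul]

/-- Comparing `φ`-densities of `ψ(· v)` and `ψ(v ·)` gives `σ' = α⁻¹ ∘ β`, and conjugating `σ'⁻¹` by
`S` gives `σ`. For `δ = (φ ⊗ ι)Δ(e)` with `φ(e) = 1`, right multiplication by `δ` is `α` and left
multiplication is `β ∘ σ⁻¹`; both are bijective, so `δ` is invertible. -/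
theorem nonempty_modularData : Nonempty H.ModularData := by
  obtain ⟨α, hα⟩ := H.exists_equiv_ψ_mul
  obtain ⟨β, hβ⟩ := H.exists_equiv_mul_ψ
  let σ' : A ≃ₗ[ℂ] A := β.trans α.symm
  have hσ' : ∀ a b, H.ψ (a * b) = H.ψ (b * σ' a) := fun a b => by
    rw [← hβ, ← hα]
    simp [σ']
  let σ : A ≃ₗ[ℂ] A := H.S.symm.trans (σ'.symm.trans H.S)
  have hσ : ∀ a b, H.φ (a * b) = H.φ (b * σ a) := fun a b => by
    have := hσ' (σ'.symm (H.S.symm a)) (H.S.symm b)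
    simpa [ψ_apply, H.S_mul, σ] using this.symm
  obtain ⟨e, he⟩ := H.exists_φ_eq_one
  have hδ := H.modularElement_spec e he
  set δ := H.modularElement e
  have hr : δ.rmul = α.toLinearMap := LinearMap.ext fun a => H.eq_of_forall_φ_left fun c => by
    rw [← rmul_mul_left, H.φ_rmul_of_spec hδ, LinearEquiv.coe_coe, hα]
  have hl : δ.lmul = (σ.symm.trans β).toLinearMap := by
    refine LinearMap.ext fun a => H.eq_of_forall_φ_left fun c => ?_
    obtain ⟨a, rfl⟩ := σ.surjective a
    rw [mul_lmul, ← hσ, ← rmul_mul_left, H.φ_rmul_of_spec hδ, LinearEquiv.coe_coe,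
      LinearEquiv.trans_apply, LinearEquiv.symm_apply_apply, hβ]
  have hu : IsUnit δ := Mult.isUnit_of_bijective (by rw [hl]; exact (σ.symm.trans β).bijective)
    (by rw [hr]; exact α.bijective)
  obtain ⟨u, hu⟩ := hu
  exact ⟨{
    δ := u
    δ_spec := hu ▸ hδ
    σ := σ
    σ_mul := map_mul_of_modular H.faithful_φ σ hσ
    σ_spec := hσ
    σ' := σ'
    σ'_mul := map_mul_of_modular H.faithful_ψ σ' hσ'
    σ'_spec := hσ' }⟩

/-! ### The modular automorphisms, `S²` and the character `χ` -/

namespace ModularData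

variable {H} (M : H.ModularData)

theorem φ_rmul (b : A) : H.φ ((M.δ : Mult A).rmul b) = H.ψ b := H.φ_rmul_of_spec M.δ_spec b

/-- `σ'(a) δ = δ σ(a)`. -/
theorem rmul_σ' (a : A) : (M.δ : Mult A).rmul (M.σ' a) = (M.δ : Mult A).lmul (M.σ a) := by
  refine H.eq_of_forall_φ_left fun b => ?_
  rw [← rmul_mul_left, M.φ_rmul, ← M.σ'_spec, mul_lmul, ← M.σ_spec, ← rmul_mul_left, M.φ_rmul]

/-- The scaling constant of `φ` under `S²` appears on both sides of the modular identity and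
cancels. -/
theorem σ_S_S (a : A) : M.σ (H.S (H.S a)) = H.S (H.S (M.σ a)) := by
  refine H.eq_of_forall_φ_left fun b => ?_
  obtain ⟨τ, -, hτ⟩ := H.exists_φ_S_S
  obtain ⟨b, rfl⟩ := H.S.surjective b
  obtain ⟨b, rfl⟩ := H.S.surjective b
  rw [← M.σ_spec, ← H.S_mul, ← H.S_mul, ← H.S_mul, ← H.S_mul, hτ, hτ, M.σ_spec]

/-- The character `ε ∘ σ⁻¹`, which is the modular element of the dual. -/
def χ : Module.Dual ℂ A := H.ε ∘ₗ M.σ.symm.toLinearMap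

@[simp] theorem χ_σ (a : A) : M.χ (M.σ a) = H.ε a := by simp [χ]

theorem χ_mul (a b : A) : M.χ (a * b) = M.χ a * M.χ b := by
  obtain ⟨a, rfl⟩ := M.σ.surjective a
  obtain ⟨b, rfl⟩ := M.σ.surjective b
  rw [← M.σ_mul, χ_σ, χ_σ, χ_σ, H.ε_mul]

theorem exists_χ_eq_one : ∃ e, M.χ e = 1 := by
  obtain ⟨e, he⟩ := H.exists_ε_eq_one
  exact ⟨M.σ e, by rw [χ_σ, he]⟩

/-- Both modular automorphisms give the same character. -/
@[simp] theorem χ_σ' (a : A) : M.χ (M.σ' a) = H.ε a := by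
  rw [← M.χ_σ]
  obtain ⟨w, hw⟩ := M.exists_χ_eq_one
  obtain ⟨v, hv⟩ : ∃ v, (M.δ : Mult A).lmul v = w := ⟨_, Mult.lmul_inv_apply M.δ w⟩
  -- `χ` is not defined on `M(A)`, so `δ` is enclosed between `w` and `v` with `δv = w`. Replacing
  -- `σ'(a)δ` by `δσ(a)` then changes only the character value sought, since `χ(wδ)χ(v) = 1`.
  have h1 : M.χ (w * (M.δ : Mult A).rmul (M.σ' a) * v) = M.χ (M.σ' a) := by
    rw [mul_assoc, ← mul_lmul, hv, χ_mul, χ_mul, hw, one_mul, mul_one]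
  have h2 : M.χ ((M.δ : Mult A).rmul w) * M.χ v = 1 := by
    rw [← χ_mul, ← mul_lmul, hv, χ_mul, hw, one_mul]
  rw [← h1, M.rmul_σ', mul_lmul, χ_mul, χ_mul, mul_right_comm, h2, one_mul]

theorem sliceR_φ_Δl2 (a b : A) : sliceR H.φ (H.Δl2 a b) = sliceR H.φ (H.Δr2 b (M.σ a)) := by
  refine H.eq_of_forall_φ_left fun p => ?_
  rw [fubini_l1_l2, fubini_l1_r2, M.σ_spec]

theorem sliceL_ψ_Δl1 (a b : A) : sliceL H.ψ (H.Δl1 a b) = sliceL H.ψ (H.Δr1 b (M.σ' a)) := by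
  refine H.eq_of_forall_φ_right fun p => ?_
  rw [← fubini_l1_r2, ← fubini_r1_r2, M.σ'_spec]

/-- `Δ(σ(a)) = (S² ⊗ σ)Δ(a)`, sliced on the second leg. -/
theorem S_S_sliceR_φ (a b : A) :
    H.S (H.S (sliceR H.φ (H.Δr2 a b))) = sliceR H.φ (H.Δl2 b (M.σ a)) := by
  rw [H.S_spec, M.sliceR_φ_Δl2, H.S_spec]

/-- `Δ(σ'(a)) = (σ' ⊗ S⁻²)Δ(a)`, sliced on the first leg. -/
theorem S_S_sliceL_ψ (a b : A) :
    H.S (H.S (sliceL H.ψ (H.Δl1 b (M.σ' a)))) = sliceL H.ψ (H.Δr1 a b) := by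
  rw [S_sliceL_ψ, ← M.sliceL_ψ_Δl1, S_sliceL_ψ]

/-- `Δ(σ(a)) = (S² ⊗ σ)Δ(a)` with the first leg integrated instead of the second, so that `χ` can be
applied to the leg carrying `σ`. -/
theorem sliceL_φ_Δr1_σ (a d : A) : sliceL H.φ (H.Δr1 (M.σ a) (H.S (H.S d))) =
    M.σ (sliceL (H.φ ∘ₗ H.S.toLinearMap ∘ₗ H.S.toLinearMap) (H.Δr1 a d)) := by
  refine H.eq_of_forall_φ_left fun b => ?_
  rw [← M.σ_spec, ← fubini_r1_l2, ← M.S_S_sliceR_φ, ← H.S_mul, ← H.S_mul, ← fubini_r1_r2]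
  rfl

theorem sliceR_φ_Δr2_σ' (a d : A) : sliceR H.φ (H.Δr2 (M.σ' a) d) =
    M.σ' (sliceR (H.φ ∘ₗ H.S.symm.toLinearMap ∘ₗ H.S.symm.toLinearMap)
      (H.Δr2 a (H.S (H.S d)))) := by
  refine H.faithful_ψ.eq_right fun b => ?_
  rw [← M.σ'_spec, fubini_l1_r2, fubini_r1_r2, ← M.S_S_sliceL_ψ, ← H.S_mul, ← H.S_mul]
  simp

/-- This says `χ ▷ σ(a) = S²(a)`, tested against `ζ`: on the second leg `χ ∘ σ = ε`, and the counit
collapses the comultiplication. -/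
theorem χ_actR_σ (a : A) (ζ : H.Hat) :
    M.χ (H.actR ζ (M.σ a)) = (ζ : Module.Dual ℂ A) (H.S (H.S a)) := by
  obtain ⟨d, rfl⟩ := H.hatEquiv.surjective ζ
  obtain ⟨d, rfl⟩ := H.S.surjective d
  obtain ⟨d, rfl⟩ := H.S.surjective d
  rw [actR_apply, LinearEquiv.symm_apply_apply, sliceL_φ_Δr1_σ, χ_σ, ← apply_sliceR, sliceR_ε_Δr1,
    hatEquiv_coe, toDual_apply, ← H.S_mul, ← H.S_mul]
  rfl

theorem χ_actL_σ' (a : A) (ζ : H.Hat) :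
    M.χ (H.actL ζ (M.σ' a)) = (ζ : Module.Dual ℂ A) (H.S.symm (H.S.symm a)) := by
  obtain ⟨d, rfl⟩ := H.hatEquiv.surjective ζ
  rw [actL_apply, LinearEquiv.symm_apply_apply, sliceR_φ_Δr2_σ', χ_σ', apply_sliceR, sliceL_ε_Δr2,
    hatEquiv_coe, toDual_apply]
  simp [S_symm_mul]

end ModularData

end AlgQuantumHypergroup

/-! ### Functionals that define multipliers -/

section Lift

variable {U V W : Type*} [AddCommGroup U] [Module ℂ U] [AddCommGroup V] [Module ℂ V]
  [AddCommGroup W] [Module ℂ W]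

/-- The lift of a linear map through an injective linear map. -/
def LinearMap.liftOfInjective (i : V →ₗ[ℂ] W) (hi : Function.Injective i) (g : U →ₗ[ℂ] W)
    (h : ∀ u, ∃ v, i v = g u) : U →ₗ[ℂ] V :=
  (LinearEquiv.ofInjective i hi).symm.toLinearMap ∘ₗ g.codRestrict (LinearMap.range i) h

theorem LinearMap.liftOfInjective_spec (i : V →ₗ[ℂ] W) (hi : Function.Injective i)
    (g : U →ₗ[ℂ] W) (h : ∀ u, ∃ v, i v = g u) (u : U) :
    i (LinearMap.liftOfInjective i hi g h u) = g u :=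
  congrArg Subtype.val
    ((LinearEquiv.ofInjective i hi).apply_symm_apply (g.codRestrict (LinearMap.range i) h u))

end Lift

/-- An algebra `B` of functionals on a `B`-bimodule `X`, with product given by
`⟨b b', x⟩ = ⟨b, b' ▷ x⟩ = ⟨b', x ◁ b⟩`. -/
structure BimodulePairing (B X : Type*) [NonUnitalRing B] [Module ℂ B] [IsScalarTower ℂ B B]
    [SMulCommClass ℂ B B] [AddCommGroup X] [Module ℂ X] where
  pair : B →ₗ[ℂ] Module.Dual ℂ X
  actL : B →ₗ[ℂ] X →ₗ[ℂ] X
  actR : B →ₗ[ℂ] X →ₗ[ℂ] X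
  pair_injective : Function.Injective pair
  pair_mul_left : ∀ b b' x, pair (b * b') x = pair b (actL b' x)
  pair_mul_right : ∀ b b' x, pair (b * b') x = pair b' (actR b x)
  actL_mul : ∀ b b' x, actL (b * b') x = actL b (actL b' x)
  actR_mul : ∀ b b' x, actR (b * b') x = actR b' (actR b x)
  actL_actR : ∀ b b' x, actL b (actR b' x) = actR b' (actL b x)

namespace BimodulePairing

variable {B X : Type*} [NonUnitalRing B] [Module ℂ B] [IsScalarTower ℂ B B]
    [SMulCommClass ℂ B B] [AddCommGroup X] [Module ℂ X] (P : BimodulePairing B X)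

theorem ext {b c : B} (h : ∀ x, P.pair b x = P.pair c x) : b = c :=
  P.pair_injective (LinearMap.ext h)

/-- A functional `f` on `X` such that all `f(b ▷ ·)` and `f(· ◁ b)` are given by elements of `B`
defines a multiplier of `B`. -/
def mult (f : Module.Dual ℂ X) (hl : ∀ b, ∃ c, P.pair c = P.actL.compr₂ f b)
    (hr : ∀ b, ∃ c, P.pair c = P.actR.compr₂ f b) : Mult B :=
  ⟨(LinearMap.liftOfInjective P.pair P.pair_injective _ hl,
    MulOpposite.op (LinearMap.liftOfInjective P.pair P.pair_injective _ hr)), by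
    refine ⟨fun a b => P.ext fun x => ?_, fun a b => P.ext fun x => ?_,
      fun a b => P.ext fun x => ?_⟩
    · simp [P.pair_mul_left, LinearMap.liftOfInjective_spec, P.actL_mul]
    · simp [P.pair_mul_right, LinearMap.liftOfInjective_spec, P.actR_mul]
    · simp only [MulOpposite.unop_op]
      rw [P.pair_mul_right, P.pair_mul_left]
      simp [LinearMap.liftOfInjective_spec, P.actL_actR]⟩

section

variable (f : Module.Dual ℂ X) (hl : ∀ b, ∃ c, P.pair c = P.actL.compr₂ f b)
  (hr : ∀ b, ∃ c, P.pair c = P.actR.compr₂ f b)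

theorem pair_mult_lmul (b : B) (x : X) : P.pair ((P.mult f hl hr).lmul b) x = f (P.actL b x) :=
  congrArg (fun g => g x) (LinearMap.liftOfInjective_spec P.pair P.pair_injective _ hl b)

theorem pair_mult_rmul (b : B) (x : X) : P.pair ((P.mult f hl hr).rmul b) x = f (P.actR b x) :=
  congrArg (fun g => g x) (LinearMap.liftOfInjective_spec P.pair P.pair_injective _ hr b)

end

end BimodulePairing

namespace AlgQuantumHypergroup

variable {A : Type*} [NonUnitalRing A] [Module ℂ A] [IsScalarTower ℂ A A] [SMulCommClass ℂ A A]
  (H : AlgQuantumHypergroup A)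

open Mult

/-! ### The dual algebra as an algebra of functionals -/

@[simp] theorem hatEquiv_apply (a x : A) :
    (H.hatEquiv a : Module.Dual ℂ A) x = H.φ (x * a) := rfl

theorem eq_of_forall_hat {x y : A}
    (h : ∀ ζ : H.Hat, (ζ : Module.Dual ℂ A) x = (ζ : Module.Dual ℂ A) y) : x = y :=
  H.eq_of_forall_φ_right fun c => h (H.hatEquiv c)

theorem hat_ext {ω ω' : H.Hat}
    (h : ∀ x, (ω : Module.Dual ℂ A) x = (ω' : Module.Dual ℂ A) x) : ω = ω' :=
  Subtype.ext (LinearMap.ext h)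

theorem hat_mul_apply_actR (ω ω' : H.Hat) (x : A) :
    ((ω * ω' : H.Hat) : Module.Dual ℂ A) x = (ω' : Module.Dual ℂ A) (H.actR ω x) := by
  rw [hat_mul_apply, hat_apply, hat_apply, actL_apply, actR_apply, fubini_r1_r2]

theorem actR_mul (ω ω' : H.Hat) (x : A) : H.actR (ω * ω') x = H.actR ω' (H.actR ω x) :=
  H.eq_of_forall_hat fun ζ => by
    rw [← hat_mul_apply_actR, ← hat_mul_apply_actR, ← hat_mul_apply_actR, mul_assoc]

theorem actL_actR (ω ω' : H.Hat) (x : A) :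
    H.actL ω (H.actR ω' x) = H.actR ω' (H.actL ω x) :=
  H.eq_of_forall_hat fun ζ => by
    rw [← hat_mul_apply, ← hat_mul_apply_actR, ← hat_mul_apply_actR, ← hat_mul_apply, mul_assoc]

theorem exists_actL_eq (a : A) : ∃ ω : H.Hat, H.actL ω a = a := by
  obtain ⟨c, hc⟩ := H.exists_sliceR_Δr2_eq H.faithful_φ a
  exact ⟨H.hatEquiv c, by rw [actL_apply, LinearEquiv.symm_apply_apply, hc]⟩

theorem exists_actR_eq (a : A) : ∃ ω : H.Hat, H.actR ω a = a := by
  obtain ⟨c, hc⟩ := H.exists_sliceL_Δr1_eq H.faithful_φ a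
  exact ⟨H.hatEquiv c, by rw [actR_apply, LinearEquiv.symm_apply_apply, hc]⟩

/-- The dual algebra as an algebra of functionals on `A`. -/
def pairing : BimodulePairing H.Hat A where
  pair := H.Hat.subtype
  actL := H.actL
  actR := H.actR
  pair_injective := Subtype.val_injective
  pair_mul_left := H.hat_mul_apply
  pair_mul_right := H.hat_mul_apply_actR
  actL_mul := H.actL_mul
  actR_mul := H.actR_mul
  actL_actR := H.actL_actR

/-- Evaluation of the functionals in the dual algebra. -/
def eval (x : A) : Module.Dual ℂ H.Hat := LinearMap.applyₗ x ∘ₗ H.Hat.subtype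

@[simp] theorem eval_apply (x : A) (ω : H.Hat) : H.eval x ω = (ω : Module.Dual ℂ A) x := rfl

theorem sliceL_eval_apply (t : H.Hat ⊗[ℂ] H.Hat) (x y : A) :
    (sliceL (H.eval x) t : Module.Dual ℂ A) y = H.hatPair t (x ⊗ₜ y) := by
  induction t with
  | zero => simp
  | add s t hs ht => simp only [map_add, Submodule.coe_add, LinearMap.add_apply, hs, ht]
  | tmul p q => simp

theorem sliceR_eval_apply (t : H.Hat ⊗[ℂ] H.Hat) (x y : A) :
    (sliceR (H.eval y) t : Module.Dual ℂ A) x = H.hatPair t (x ⊗ₜ y) := by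
  induction t with
  | zero => simp
  | add s t hs ht => simp only [map_add, Submodule.coe_add, LinearMap.add_apply, hs, ht]
  | tmul p q => simp [mul_comm]

theorem sliceL_apply (g : Module.Dual ℂ H.Hat) (t : H.Hat ⊗[ℂ] H.Hat) (y : A) :
    (sliceL g t : Module.Dual ℂ A) y = g (sliceR (H.eval y) t) := by
  rw [apply_sliceR, eval_apply]

theorem hatPair_injective : Function.Injective H.hatPair := by
  rw [← LinearMap.ker_eq_bot, LinearMap.ker_eq_bot']
  intro t ht
  refine eq_zero_of_sliceL H.eval (fun ω hω => H.hat_ext hω) fun x => H.hat_ext fun y => ?_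
  rw [sliceL_eval_apply, ht]
  rfl

theorem hatPair_ext {s t : H.Hat ⊗[ℂ] H.Hat}
    (h : ∀ x y, H.hatPair s (x ⊗ₜ y) = H.hatPair t (x ⊗ₜ y)) : s = t :=
  H.hatPair_injective (TensorProduct.ext' h)

/-- The action of tensors, leg by leg. -/
def tensorAct (T : H.Hat →ₗ[ℂ] A →ₗ[ℂ] A) :
    H.Hat ⊗[ℂ] H.Hat →ₗ[ℂ] A ⊗[ℂ] A →ₗ[ℂ] A ⊗[ℂ] A :=
  TensorProduct.lift ((TensorProduct.mapBilinear (RingHom.id ℂ) A A A A).compl₁₂ T T)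

@[simp] theorem tensorAct_tmul (T : H.Hat →ₗ[ℂ] A →ₗ[ℂ] A) (η η' : H.Hat) (x y : A) :
    H.tensorAct T (η ⊗ₜ η') (x ⊗ₜ y) = T η x ⊗ₜ T η' y := rfl

/-- The tensor square of the dual algebra as an algebra of functionals on `A ⊗ A`. -/
def tensorPairing : BimodulePairing (H.Hat ⊗[ℂ] H.Hat) (A ⊗[ℂ] A) where
  pair := H.hatPair
  actL := H.tensorAct H.actL
  actR := H.tensorAct H.actR
  pair_injective := H.hatPair_injective
  pair_mul_left s t z := by
    induction s with
    | zero => simp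
    | add a b ha hb => simp only [add_mul, map_add, LinearMap.add_apply, ha, hb]
    | tmul p q =>
      induction t with
      | zero => simp
      | add a b ha hb => simp only [mul_add, map_add, LinearMap.add_apply, ha, hb]
      | tmul p' q' =>
        induction z with
        | zero => simp
        | add a b ha hb => simp only [map_add, ha, hb]
        | tmul x y => simp [hat_mul_apply]
  pair_mul_right s t z := by
    induction s with
    | zero => simp
    | add a b ha hb => simp only [add_mul, map_add, LinearMap.add_apply, ha, hb]
    | tmul p q =>
      induction t with
      | zero => simp
      | add a b ha hb => simp only [mul_add, map_add, LinearMap.add_apply, ha, hb]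
      | tmul p' q' =>
        induction z with
        | zero => simp
        | add a b ha hb => simp only [map_add, ha, hb]
        | tmul x y => simp [hat_mul_apply_actR]
  actL_mul s t z := by
    induction s with
    | zero => simp
    | add a b ha hb => simp only [add_mul, map_add, LinearMap.add_apply, ha, hb]
    | tmul p q =>
      induction t with
      | zero => simp
      | add a b ha hb => simp only [mul_add, map_add, LinearMap.add_apply, ha, hb]
      | tmul p' q' =>
        induction z with
        | zero => simp
        | add a b ha hb => simp only [map_add, ha, hb]
        | tmul x y => simp [actL_mul]
  actR_mul s t z := by
    induction s with
    | zero => simp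
    | add a b ha hb => simp only [add_mul, map_add, LinearMap.add_apply, ha, hb]
    | tmul p q =>
      induction t with
      | zero => simp
      | add a b ha hb => simp only [mul_add, map_add, LinearMap.add_apply, ha, hb]
      | tmul p' q' =>
        induction z with
        | zero => simp
        | add a b ha hb => simp only [map_add, ha, hb]
        | tmul x y => simp [actR_mul]
  actL_actR s t z := by
    induction s with
    | zero => simp
    | add a b ha hb => simp only [map_add, LinearMap.add_apply, ha, hb]
    | tmul p q =>
      induction t with
      | zero => simp
      | add a b ha hb => simp only [map_add, LinearMap.add_apply, ha, hb]
      | tmul p' q' =>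
        induction z with
        | zero => simp
        | add a b ha hb => simp only [map_add, ha, hb]
        | tmul x y => simp [actL_actR]

/-- With local units `η ▷ x = x` and `η' ▷ y = y`, the value of `t` at `x ⊗ y` equals that of `t(η ⊗
η')`, which is zero. -/
theorem hat_tensor_nondeg (t : H.Hat ⊗[ℂ] H.Hat) (h : ∀ s, t * s = 0) : t = 0 := by
  refine H.hatPair_ext fun x y => ?_
  obtain ⟨η, hη⟩ := H.exists_actL_eq x
  obtain ⟨η', hη'⟩ := H.exists_actL_eq y
  have := H.tensorPairing.pair_mul_left t (η ⊗ₜ η') (x ⊗ₜ y)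
  change _ = H.hatPair t (H.actL η x ⊗ₜ H.actL η' y) at this
  rw [h, hη, hη'] at this
  rw [← this]
  simp

theorem hat_tensor_of_injective :
    Function.Injective (Mult.of : H.Hat ⊗[ℂ] H.Hat → Mult (H.Hat ⊗[ℂ] H.Hat)) :=
  Mult.of_injective H.hat_tensor_nondeg

theorem hatPair_leg1_lmul (η : H.Hat) (t : H.Hat ⊗[ℂ] H.Hat) (x y : A) :
    H.hatPair ((leg1 η).lmul t) (x ⊗ₜ y) = H.hatPair t (H.actR η x ⊗ₜ y) := by
  induction t with
  | zero => simp
  | add s t hs ht => simp only [map_add, LinearMap.add_apply, hs, ht]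
  | tmul p q => simp [hat_mul_apply_actR]

theorem hatPair_leg1_rmul (η : H.Hat) (t : H.Hat ⊗[ℂ] H.Hat) (x y : A) :
    H.hatPair ((leg1 η).rmul t) (x ⊗ₜ y) = H.hatPair t (H.actL η x ⊗ₜ y) := by
  induction t with
  | zero => simp
  | add s t hs ht => simp only [map_add, LinearMap.add_apply, hs, ht]
  | tmul p q => simp [hat_mul_apply]

theorem hatPair_leg2_lmul (η : H.Hat) (t : H.Hat ⊗[ℂ] H.Hat) (x y : A) :
    H.hatPair ((leg2 η).lmul t) (x ⊗ₜ y) = H.hatPair t (x ⊗ₜ H.actR η y) := by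
  induction t with
  | zero => simp
  | add s t hs ht => simp only [map_add, LinearMap.add_apply, hs, ht]
  | tmul p q => simp [hat_mul_apply_actR]

theorem hatPair_Δl1 (ω η : H.Hat) (x y : A) :
    H.hatPair (ω ⊗ₜ η) (H.Δl1 x y) = (ω : Module.Dual ℂ A) (x * H.actL η y) := by
  rw [mul_actL]
  induction H.Δl1 x y with
  | zero => simp
  | add s t hs ht => simp only [map_add, hs, ht]
  | tmul p q => simp [mul_comm]

/-- `a ◁ ω` represents the slice `(ω ⊗ ι)Δ(a)`. -/
theorem actR_mul_right (ω : H.Hat) (a d : A) :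
    H.actR ω a * d = sliceL (ω : Module.Dual ℂ A) (H.Δr2 a d) := by
  refine H.eq_of_forall_φ_right fun c => ?_
  rw [mul_assoc, actR_apply, ← fubini_r1_r2, ← hat_apply, ← sliceL_leg2_rmul, ← Δr2_mul,
    ← apply_sliceR]

theorem hatPair_Δr2 (ω η : H.Hat) (x y : A) :
    H.hatPair (ω ⊗ₜ η) (H.Δr2 x y) = (η : Module.Dual ℂ A) (H.actR ω x * y) := by
  rw [actR_mul_right]
  induction H.Δr2 x y with
  | zero => simp
  | add s t hs ht => simp only [map_add, hs, ht]
  | tmul p q => simp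

/-- The action is defined through the `φ`-density of `ω`; any other functional representing `ω`
serves equally. It is used with `f = ψ`, where `S_sliceL_ψ` applies. -/
theorem actR_eq_sliceL_of_apply {f : Module.Dual ℂ A} (ω : H.Hat) (a : A)
    (h : ∀ x, (ω : Module.Dual ℂ A) x = f (x * a)) (x : A) :
    H.actR ω x = sliceL f (H.Δr1 x a) := by
  refine H.eq_of_forall_φ_right fun c => ?_
  rw [actR_apply, ← fubini_r1_r2, ← fubini_r1_r2, ← hat_apply, h]

end AlgQuantumHypergroup

/-! ### The comultiplication of the dual algebra -/

namespace AlgQuantumHypergroup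

variable {A : Type*} [NonUnitalRing A] [Module ℂ A] [IsScalarTower ℂ A A] [SMulCommClass ℂ A A]
  (H : AlgQuantumHypergroup A)

open Mult

theorem hatPair_map (F G : A →ₗ[ℂ] H.Hat) (u : A ⊗[ℂ] A) (x y : A) :
    H.hatPair (TensorProduct.map F G u) (x ⊗ₜ y) =
      (G (sliceL (H.eval x ∘ₗ F) u) : Module.Dual ℂ A) y := by
  induction u with
  | zero => simp
  | add s t hs ht => simp only [map_add, Submodule.coe_add, LinearMap.add_apply, hs, ht]
  | tmul p q => simp

theorem hatPair_map' (F G : A →ₗ[ℂ] H.Hat) (u : A ⊗[ℂ] A) (x y : A) :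
    H.hatPair (TensorProduct.map F G u) (x ⊗ₜ y) =
      (F (sliceR (H.eval y ∘ₗ G) u) : Module.Dual ℂ A) x := by
  induction u with
  | zero => simp
  | add s t hs ht => simp only [map_add, Submodule.coe_add, LinearMap.add_apply, hs, ht]
  | tmul p q => simp [mul_comm]

namespace ModularData

variable {H} (M : H.ModularData)

/-- The element `ψ(· a)` of the dual algebra. -/
def hatψ : A →ₗ[ℂ] H.Hat := H.hatEquiv.toLinearMap ∘ₗ (M.δ : Mult A).rmul

theorem hatψ_apply (a x : A) : (M.hatψ a : Module.Dual ℂ A) x = H.ψ (x * a) := by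
  rw [← M.φ_rmul, rmul_mul_left]
  rfl

theorem hatψ_surjective (M : H.ModularData) : Function.Surjective M.hatψ :=
  H.hatEquiv.surjective.comp fun a => ⟨_, Mult.rmul_inv_apply M.δ a⟩

theorem actR_hatψ (a x : A) : H.actR (M.hatψ a) x = H.S (sliceL H.ψ (H.Δl1 x a)) := by
  rw [H.actR_eq_sliceL_of_apply _ a (M.hatψ_apply a), H.S_sliceL_ψ]

/-- The element `(ω ⊗ 1)Δ̂(ω')` of `Â ⊗ Â`. -/
theorem exists_hatPair_eq_actR_mul (M : H.ModularData) (ω ω' : H.Hat) :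
    ∃ t, ∀ x y, H.hatPair t (x ⊗ₜ y) = (ω' : Module.Dual ℂ A) (H.actR ω x * y) := by
  obtain ⟨a, rfl⟩ := M.hatψ_surjective ω
  -- This writes `ω' = φ(S(d) ·)`. As `x ◁ ω` is `S` of a slice, the factor `S(d)` can be absorbed
  -- inside `S`, and the tensor comes from `Δ(a)(1 ⊗ d)`.
  obtain ⟨d, rfl⟩ := (H.S.trans (M.σ.trans H.hatEquiv)).surjective ω'
  refine ⟨TensorProduct.map M.hatψ (H.S.trans (M.σ.trans H.hatEquiv)).toLinearMap (H.Δr2 a d),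
    fun x y => ?_⟩
  have h1 : H.eval x ∘ₗ M.hatψ = H.ψ ∘ₗ LinearMap.mulLeft ℂ x :=
    LinearMap.ext fun b => M.hatψ_apply b x
  rw [hatPair_map, h1, ← sliceL_leg1_lmul, leg1_Δr2, sliceL_leg2_rmul, actR_hatψ]
  simp only [LinearEquiv.coe_coe, LinearEquiv.trans_apply, hatEquiv_apply]
  rw [← M.σ_spec, ← M.σ_spec, ← mul_assoc, ← H.S_mul]

/-- The element `(1 ⊗ η)Δ̂(ω)` of `Â ⊗ Â`. -/
theorem exists_hatPair_eq_mul_actR (M : H.ModularData) (ω η : H.Hat) :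
    ∃ t, ∀ x y, H.hatPair t (x ⊗ₜ y) = (ω : Module.Dual ℂ A) (x * H.actR η y) := by
  obtain ⟨a, rfl⟩ := M.hatψ_surjective η
  obtain ⟨d, rfl⟩ := (H.S.trans H.hatEquiv).surjective ω
  refine ⟨TensorProduct.map (H.S.trans H.hatEquiv).toLinearMap M.hatψ
    (TensorProduct.comm ℂ A A (H.Δl2 d a)), fun x y => ?_⟩
  have h1 : H.eval y ∘ₗ M.hatψ = H.ψ ∘ₗ LinearMap.mulLeft ℂ y :=
    LinearMap.ext fun b => M.hatψ_apply b y
  rw [hatPair_map', h1, ← sliceL_comm, TensorProduct.comm_comm, ← sliceL_leg1_lmul, leg1_Δl2,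
    sliceL_leg2_lmul, actR_hatψ]
  simp only [LinearEquiv.coe_coe, LinearEquiv.trans_apply, hatEquiv_apply]
  rw [mul_assoc, ← H.S_mul]

end ModularData

/-- The element `Δ̂(ω)(1 ⊗ η)` of `Â ⊗ Â`. -/
theorem exists_hatPair_eq_mul_actL (ω η : H.Hat) :
    ∃ t, ∀ x y, H.hatPair t (x ⊗ₜ y) = (ω : Module.Dual ℂ A) (x * H.actL η y) := by
  obtain ⟨b, rfl⟩ := H.hatEquiv.surjective η
  obtain ⟨e, rfl⟩ := H.hatEquiv.surjective ω
  -- With densities `b` and `e`, the product `(η ▷ y)e` equals `S⁻¹(S(e) S(η ▷ y))`, and the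
  -- antipode formula turns `S(η ▷ y)` into a slice of `(1 ⊗ y)Δ(b)`.
  refine ⟨TensorProduct.map (H.S.symm.trans H.hatEquiv).toLinearMap H.hatEquiv.toLinearMap
    (H.Δl1 (H.S e) b), fun x y => ?_⟩
  have h1 : H.eval y ∘ₗ H.hatEquiv.toLinearMap = H.φ ∘ₗ LinearMap.mulLeft ℂ y := rfl
  rw [hatPair_map', h1, ← sliceR_leg2_lmul, ← leg1_Δl2, sliceR_leg1_lmul, ← H.S_spec, ← H.S_mul,
    actL_apply]
  simp [mul_assoc]

/-- The functional `x ⊗ y ↦ ω(x y)`. -/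
def mulFunctional : H.Hat →ₗ[ℂ] Module.Dual ℂ (A ⊗[ℂ] A) where
  toFun ω := (ω : Module.Dual ℂ A) ∘ₗ LinearMap.mul' ℂ A
  map_add' _ _ := rfl
  map_smul' _ _ := rfl

/-- One of the two conditions under which `x ⊗ y ↦ ω(xy)` defines a multiplier of `Â ⊗ Â`. One leg
of the action gives an element of `Â ⊗ Â` already; the other is multiplication by `η ⊗ 1`. -/
theorem exists_hatPair_eq_actL (ω : H.Hat) (s : H.Hat ⊗[ℂ] H.Hat) :
    ∃ t, H.tensorPairing.pair t = H.tensorPairing.actL.compr₂ (H.mulFunctional ω) s := by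
  induction s with
  | zero => exact ⟨0, by simp⟩
  | add a b ha hb =>
    obtain ⟨t, ht⟩ := ha
    obtain ⟨t', ht'⟩ := hb
    exact ⟨t + t', by rw [map_add, map_add, ht, ht']⟩
  | tmul η η' =>
    obtain ⟨t, ht⟩ := H.exists_hatPair_eq_mul_actL ω η'
    exact ⟨(leg1 η).rmul t, TensorProduct.ext' fun x y =>
      (H.hatPair_leg1_rmul η t x y).trans (ht _ _)⟩

namespace ModularData

variable {H} (M : H.ModularData)

theorem exists_hatPair_eq_actR (M : H.ModularData) (ω : H.Hat) (s : H.Hat ⊗[ℂ] H.Hat) :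
    ∃ t, H.tensorPairing.pair t = H.tensorPairing.actR.compr₂ (H.mulFunctional ω) s := by
  induction s with
  | zero => exact ⟨0, by simp⟩
  | add a b ha hb =>
    obtain ⟨t, ht⟩ := ha
    obtain ⟨t', ht'⟩ := hb
    exact ⟨t + t', by rw [map_add, map_add, ht, ht']⟩
  | tmul η η' =>
    obtain ⟨t, ht⟩ := M.exists_hatPair_eq_actR_mul η ω
    exact ⟨(leg2 η').lmul t, TensorProduct.ext' fun x y =>
      (H.hatPair_leg2_lmul η' t x y).trans (ht _ _)⟩

/-- The comultiplication of the dual algebra. -/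
def dualΔ : H.Hat →ₗ[ℂ] Mult (H.Hat ⊗[ℂ] H.Hat) where
  toFun ω := H.tensorPairing.mult (H.mulFunctional ω) (H.exists_hatPair_eq_actL ω)
    (M.exists_hatPair_eq_actR ω)
  map_add' ω ω' := Mult.ext_lmul H.hat_tensor_nondeg fun t => H.tensorPairing.ext fun z => by
    change _ = H.tensorPairing.pair (Mult.lmul _ t + Mult.lmul _ t) z
    refine (BimodulePairing.pair_mult_lmul _ _ _ _ t z).trans ?_
    rw [map_add H.tensorPairing.pair, LinearMap.add_apply, BimodulePairing.pair_mult_lmul,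
      BimodulePairing.pair_mult_lmul, map_add H.mulFunctional, LinearMap.add_apply]
  map_smul' r ω := Mult.ext_lmul H.hat_tensor_nondeg fun t => H.tensorPairing.ext fun z => by
    change _ = H.tensorPairing.pair (r • Mult.lmul _ t) z
    refine (BimodulePairing.pair_mult_lmul _ _ _ _ t z).trans ?_
    rw [map_smul H.tensorPairing.pair, LinearMap.smul_apply, BimodulePairing.pair_mult_lmul,
      map_smul H.mulFunctional, LinearMap.smul_apply]

theorem hatPair_dualΔ_lmul (ω : H.Hat) (s : H.Hat ⊗[ℂ] H.Hat) (z : A ⊗[ℂ] A) :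
    H.hatPair ((M.dualΔ ω).lmul s) z = H.mulFunctional ω (H.tensorPairing.actL s z) :=
  H.tensorPairing.pair_mult_lmul _ _ _ s z

theorem of_eq_dualΔ_mul_leg2 {ω η : H.Hat} {t : H.Hat ⊗[ℂ] H.Hat}
    (ht : ∀ x y, H.hatPair t (x ⊗ₜ y) = (ω : Module.Dual ℂ A) (x * H.actL η y)) :
    of t = M.dualΔ ω * leg2 η := by
  refine Mult.ext_lmul H.hat_tensor_nondeg fun s => H.hatPair_ext fun x y => ?_
  rw [of_lmul, lmul_mul, hatPair_dualΔ_lmul]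
  change H.tensorPairing.pair _ _ = _
  rw [BimodulePairing.pair_mul_left]
  induction s with
  | zero => simp
  | add a b ha hb => simp only [map_add, LinearMap.add_apply, ha, hb]
  | tmul p q =>
    change H.hatPair t (H.actL p x ⊗ₜ H.actL q y) =
      (ω : Module.Dual ℂ A) (H.actL p x * H.actL (η * q) y)
    rw [ht, H.actL_mul]

theorem of_eq_leg1_mul_dualΔ {ω η : H.Hat} {t : H.Hat ⊗[ℂ] H.Hat}
    (ht : ∀ x y, H.hatPair t (x ⊗ₜ y) = (ω : Module.Dual ℂ A) (H.actR η x * y)) :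
    of t = leg1 η * M.dualΔ ω := by
  refine Mult.ext_lmul H.hat_tensor_nondeg fun s => H.hatPair_ext fun x y => ?_
  rw [of_lmul, lmul_mul, hatPair_leg1_lmul, hatPair_dualΔ_lmul]
  change H.tensorPairing.pair _ _ = _
  rw [BimodulePairing.pair_mul_left]
  induction s with
  | zero => simp
  | add a b ha hb => simp only [map_add, LinearMap.add_apply, ha, hb]
  | tmul p q =>
    change H.hatPair t (H.actL p x ⊗ₜ H.actL q y) =
      (ω : Module.Dual ℂ A) (H.actL p (H.actR η x) * H.actL q y)
    rw [ht, H.actL_actR]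

theorem of_eq_leg2_mul_dualΔ {ω η : H.Hat} {t : H.Hat ⊗[ℂ] H.Hat}
    (ht : ∀ x y, H.hatPair t (x ⊗ₜ y) = (ω : Module.Dual ℂ A) (x * H.actR η y)) :
    of t = leg2 η * M.dualΔ ω := by
  refine Mult.ext_lmul H.hat_tensor_nondeg fun s => H.hatPair_ext fun x y => ?_
  rw [of_lmul, lmul_mul, hatPair_leg2_lmul, hatPair_dualΔ_lmul]
  change H.tensorPairing.pair _ _ = _
  rw [BimodulePairing.pair_mul_left]
  induction s with
  | zero => simp
  | add a b ha hb => simp only [map_add, LinearMap.add_apply, ha, hb]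
  | tmul p q =>
    change H.hatPair t (H.actL p x ⊗ₜ H.actL q y) =
      (ω : Module.Dual ℂ A) (H.actL p x * H.actL q (H.actR η y))
    rw [ht, H.actL_actR]

/-! ### The integral and the modular element of the dual algebra -/

/-- The left integral of the dual algebra. -/
def dualφ : H.Hat →ₗ[ℂ] ℂ :=
  -- The formula is forced: `φ(· c) = ψ(· cδ⁻¹) = ψ(σ'⁻¹(cδ⁻¹) ·)` and `ε ∘ σ'⁻¹ = χ`.
  M.χ ∘ₗ (↑M.δ⁻¹ : Mult A).rmul ∘ₗ H.hatEquiv.symm.toLinearMap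

theorem dualφ_hatEquiv (c : A) : M.dualφ (H.hatEquiv c) = M.χ ((↑M.δ⁻¹ : Mult A).rmul c) := by
  simp [dualφ]

theorem dualφ_hatEquiv_mul (z c : A) :
    M.dualφ (H.hatEquiv (z * c)) = M.χ z * M.dualφ (H.hatEquiv c) := by
  rw [dualφ_hatEquiv, dualφ_hatEquiv, rmul_mul_left, χ_mul]

theorem eq_hatψ_σ' {a : A} {ω : H.Hat} (h : ∀ x, (ω : Module.Dual ℂ A) x = H.ψ (a * x)) :
    ω = M.hatψ (M.σ' a) :=
  H.hat_ext fun x => by rw [h, M.hatψ_apply, M.σ'_spec]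

theorem dualφ_spec (a : A) (ω : H.Hat) (h : ∀ x, (ω : Module.Dual ℂ A) x = H.ψ (a * x)) :
    M.dualφ ω = H.ε a := by
  rw [M.eq_hatψ_σ' h]
  change M.dualφ (H.hatEquiv _) = _
  rw [dualφ_hatEquiv, Mult.rmul_apply_inv, χ_σ']

theorem eq_dualφ {f : H.Hat →ₗ[ℂ] ℂ} (hf : ∀ (a : A) (ω : H.Hat),
    (∀ x, (ω : Module.Dual ℂ A) x = H.ψ (a * x)) → f ω = H.ε a) : f = M.dualφ := by
  ext ω
  obtain ⟨a, rfl⟩ := M.hatψ_surjective ω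
  obtain ⟨a, rfl⟩ := M.σ'.surjective a
  have h : ∀ x, (M.hatψ (M.σ' a) : Module.Dual ℂ A) x = H.ψ (a * x) := fun x => by
    rw [M.hatψ_apply, M.σ'_spec a x]
  rw [hf a _ h, M.dualφ_spec a _ h]

/-- For fixed `y` and `ω = φ(· c)`, the functional `x ↦ ω(x T(y))` has density `T(y)c`, from which
the dual integral extracts `χ(T(y))`. The map `T` is either action of a fixed element of `Â`. -/
theorem sliceL_dualφ_apply {ω : H.Hat} {t : H.Hat ⊗[ℂ] H.Hat} {T : A → A}
    (ht : ∀ x y, H.hatPair t (x ⊗ₜ y) = (ω : Module.Dual ℂ A) (x * T y)) (y : A) :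
    (sliceL M.dualφ t : Module.Dual ℂ A) y = M.dualφ ω * M.χ (T y) := by
  obtain ⟨c, rfl⟩ := H.hatEquiv.surjective ω
  have : sliceR (H.eval y) t = H.hatEquiv (T y * c) := H.hat_ext fun x => by
    rw [sliceR_eval_apply, ht, hatEquiv_apply, hatEquiv_apply, mul_assoc]
  rw [sliceL_apply, this, dualφ_hatEquiv_mul, mul_comm]

theorem exists_dualφ_eq_one : ∃ ω, M.dualφ ω = 1 := by
  obtain ⟨e, he⟩ := M.exists_χ_eq_one
  exact ⟨H.hatEquiv ((M.δ : Mult A).rmul e), by rw [dualφ_hatEquiv, Mult.rmul_apply_inv, he]⟩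

/-- Left multiplication by `χ` is a bijection of `Â`, seen on `φ`-densities: apply `S²`, then `σ'`
conjugated by right multiplication by `δ`, which exchanges `φ`- and `ψ`-densities. The factor `τ⁻¹`
compensates for `φ ∘ S² = τφ`. -/
theorem exists_equiv_χ_actL :
    ∃ E : A ≃ₗ[ℂ] A, ∀ d x,
      M.χ (H.actL (H.hatEquiv d) x) = (H.hatEquiv (E d) : Module.Dual ℂ A) x := by
  obtain ⟨τ, hτ0, hτ⟩ := H.exists_φ_S_S
  let r : A ≃ₗ[ℂ] A := LinearEquiv.ofLinearMap (M.δ : Mult A).rmul (↑M.δ⁻¹ : Mult A).rmul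
    (LinearMap.ext fun a => Mult.rmul_inv_apply M.δ a)
    (LinearMap.ext fun a => Mult.rmul_apply_inv M.δ a)
  have hr : ∀ a, H.φ (r a) = H.ψ a := M.φ_rmul
  have hr' : ∀ a b, r (a * b) = a * r b := Mult.rmul_mul_left _
  let E : A ≃ₗ[ℂ] A := (H.S.trans H.S).trans (r.symm.trans (M.σ'.trans r))
  refine ⟨E.trans (LinearEquiv.smulOfNeZero ℂ A τ⁻¹ (inv_ne_zero hτ0)), fun d x => ?_⟩
  obtain ⟨x, rfl⟩ := M.σ'.surjective x
  have h1 : H.φ (M.σ' x * E d) = τ * H.φ (H.S.symm (H.S.symm x) * d) := by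
    obtain ⟨w, hw⟩ := r.surjective (H.S (H.S d))
    have : E d = r (M.σ' w) := by simp [E, ← hw]
    rw [← hτ, H.S_mul, H.S_mul, LinearEquiv.apply_symm_apply, LinearEquiv.apply_symm_apply, this,
      ← hw, ← hr', hr, ← hr', hr, M.σ'_spec x w, M.σ'_spec w]
  rw [χ_actL_σ', hatEquiv_apply, hatEquiv_apply]
  simp [mul_smul_comm, h1, hτ0]

/-- Right multiplication by `χ` acts on densities as `τ σ ∘ S⁻²`. No conjugation by `δ` is needed,
since `σ` already belongs to `φ`. -/
theorem exists_equiv_χ_actR :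
    ∃ E : A ≃ₗ[ℂ] A, ∀ d x,
      M.χ (H.actR (H.hatEquiv d) x) = (H.hatEquiv (E d) : Module.Dual ℂ A) x := by
  obtain ⟨τ, hτ0, hτ⟩ := H.exists_φ_S_S
  let E : A ≃ₗ[ℂ] A := (H.S.symm.trans H.S.symm).trans M.σ
  refine ⟨E.trans (LinearEquiv.smulOfNeZero ℂ A τ hτ0), fun d x => ?_⟩
  obtain ⟨x, rfl⟩ := M.σ.surjective x
  obtain ⟨d, rfl⟩ := H.S.surjective d
  obtain ⟨d, rfl⟩ := H.S.surjective d
  rw [χ_actR_σ, hatEquiv_apply, hatEquiv_apply, ← H.S_mul, ← H.S_mul, hτ]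
  simp [E, mul_smul_comm, M.σ_spec x d, M.σ_spec d]

/-- The modular element of the dual algebra, given by the functional `χ`. -/
theorem exists_dualδ : ∃ u : (Mult H.Hat)ˣ,
    (∀ (η : H.Hat) (x : A), ((u : Mult H.Hat).lmul η : Module.Dual ℂ A) x = M.χ (H.actL η x)) ∧
    ∀ (η : H.Hat) (x : A), ((u : Mult H.Hat).rmul η : Module.Dual ℂ A) x = M.χ (H.actR η x) := by
  obtain ⟨E, hE⟩ := M.exists_equiv_χ_actL
  obtain ⟨F, hF⟩ := M.exists_equiv_χ_actR
  let E' : H.Hat ≃ₗ[ℂ] H.Hat := H.hatEquiv.symm.trans (E.trans H.hatEquiv)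
  let F' : H.Hat ≃ₗ[ℂ] H.Hat := H.hatEquiv.symm.trans (F.trans H.hatEquiv)
  have hE' : ∀ η, H.pairing.pair (E' η) = H.pairing.actL.compr₂ M.χ η := fun η => by
    obtain ⟨d, rfl⟩ := H.hatEquiv.surjective η
    refine LinearMap.ext fun x => ?_
    have : E' (H.hatEquiv d) = H.hatEquiv (E d) := by simp [E']
    rw [this]
    exact (hE d x).symm
  have hF' : ∀ η, H.pairing.pair (F' η) = H.pairing.actR.compr₂ M.χ η := fun η => by
    obtain ⟨d, rfl⟩ := H.hatEquiv.surjective η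
    refine LinearMap.ext fun x => ?_
    have : F' (H.hatEquiv d) = H.hatEquiv (F d) := by simp [F']
    rw [this]
    exact (hF d x).symm
  let m : Mult H.Hat := H.pairing.mult M.χ (fun η => ⟨_, hE' η⟩) (fun η => ⟨_, hF' η⟩)
  have hml : ∀ η x, (m.lmul η : Module.Dual ℂ A) x = M.χ (H.actL η x) :=
    H.pairing.pair_mult_lmul M.χ _ _
  have hmr : ∀ η x, (m.rmul η : Module.Dual ℂ A) x = M.χ (H.actR η x) :=
    H.pairing.pair_mult_rmul M.χ _ _
  have hl : m.lmul = E'.toLinearMap := LinearMap.ext fun η => H.hat_ext fun x =>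
    (hml η x).trans (congrArg (fun f => f x) (hE' η)).symm
  have hr : m.rmul = F'.toLinearMap := LinearMap.ext fun η => H.hat_ext fun x =>
    (hmr η x).trans (congrArg (fun f => f x) (hF' η)).symm
  obtain ⟨u, hu⟩ := Mult.isUnit_of_bijective (m := m) (by rw [hl]; exact E'.bijective)
    (by rw [hr]; exact F'.bijective)
  exact ⟨u, by rw [hu]; exact hml, by rw [hu]; exact hmr⟩

theorem nonempty_dualData (M : H.ModularData) : Nonempty H.DualData := by
  obtain ⟨u, hul, hur⟩ := M.exists_dualδ
  refine ⟨{
    Δ := M.dualΔ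
    Δ_left := fun ω ω' => ?_
    Δ_right := fun ω ω' => ?_
    φ := M.dualφ
    φ_spec := M.dualφ_spec
    δ := u
    δ_spec := fun ω => ⟨fun η => ?_, fun η => ?_⟩ }⟩
  · obtain ⟨t, ht⟩ := M.exists_hatPair_eq_actR_mul ω ω'
    exact ⟨t, M.of_eq_leg1_mul_dualΔ ht, fun x y => by rw [ht, hatPair_Δr2]⟩
  · obtain ⟨t, ht⟩ := H.exists_hatPair_eq_mul_actL ω ω'
    exact ⟨t, M.of_eq_dualΔ_mul_leg2 ht, fun x y => by rw [ht, hatPair_Δl1]⟩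
  · obtain ⟨t, ht⟩ := H.exists_hatPair_eq_mul_actL ω η
    refine ⟨t, M.of_eq_dualΔ_mul_leg2 ht, H.hat_ext fun y => ?_⟩
    rw [M.sliceL_dualφ_apply ht, ← hul]
    rfl
  · obtain ⟨t, ht⟩ := M.exists_hatPair_eq_mul_actR ω η
    refine ⟨t, M.of_eq_leg2_mul_dualΔ ht, H.hat_ext fun y => ?_⟩
    rw [M.sliceL_dualφ_apply ht, ← hur]
    rfl

/-- The modular element of the dual is the functional `χ`: one has `δ̂ η = (χ ⊗ η)Δ`. -/
theorem dualData_lmul (D : H.DualData) (η : H.Hat) (y : A) :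
    ((D.δ : Mult H.Hat).lmul η : Module.Dual ℂ A) y = M.χ (H.actL η y) := by
  -- Both the description of `Δ̂(ω)(1 ⊗ η)` and the defining property of `δ̂` concern the same
  -- tensor; with `φ̂(ω) = 1` its slice is `δ̂η`.
  obtain ⟨ω, hω⟩ := M.exists_dualφ_eq_one
  obtain ⟨t, ht, hpair⟩ := D.Δ_right ω η
  obtain ⟨t', ht', hslice⟩ := (D.δ_spec ω).1 η
  obtain rfl := H.hat_tensor_of_injective (ht.trans ht'.symm)
  have h1 : (sliceL M.dualφ t : Module.Dual ℂ A) y = M.dualφ ω * M.χ (H.actL η y) :=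
    M.sliceL_dualφ_apply (fun x y => by rw [hpair, hatPair_Δl1]) y
  rw [M.eq_dualφ D.φ_spec, hω, one_smul] at hslice
  rw [← hslice, h1, hω, one_mul]

/-- Follows from the left multiplication alone: with `ω ▷ a = a`, evaluate `(ζδ̂)ω = ζ(δ̂ω)` at `a`
and use that the two actions commute. -/
theorem dualData_rmul (D : H.DualData) (ζ : H.Hat) (a : A) :
    ((D.δ : Mult H.Hat).rmul ζ : Module.Dual ℂ A) a = M.χ (H.actR ζ a) := by
  obtain ⟨ω, hω⟩ := H.exists_actL_eq a
  conv_lhs => rw [← hω]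
  rw [← hat_mul_apply, ← mul_lmul, hat_mul_apply_actR, M.dualData_lmul, actL_actR, hω]

end ModularData

/-! ### The actions of multipliers of the dual algebra -/

/-- Pairing with `ζ` removes the chosen local unit, so the extended action is the transpose of right
multiplication by `m`. -/
theorem hat_apply_multActL (m : Mult H.Hat) (a : A) (ζ : H.Hat) :
    (ζ : Module.Dual ℂ A) (H.multActL m a) = (m.rmul ζ : Module.Dual ℂ A) a := by
  rw [multActL, dif_pos (H.exists_actL_eq a), ← hat_mul_apply, mul_lmul, hat_mul_apply,
    (H.exists_actL_eq a).choose_spec]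

theorem hat_apply_multActR (m : Mult H.Hat) (a : A) (ζ : H.Hat) :
    (ζ : Module.Dual ℂ A) (H.multActR a m) = (m.lmul ζ : Module.Dual ℂ A) a := by
  rw [multActR, dif_pos (H.exists_actR_eq a), ← hat_mul_apply_actR, ← mul_lmul,
    hat_mul_apply_actR, (H.exists_actR_eq a).choose_spec]

namespace ModularData

variable {H} (M : H.ModularData) (D : H.DualData)

theorem multActL_dualδ_σ (a : A) : H.multActL D.δ (M.σ a) = H.S (H.S a) :=
  H.eq_of_forall_hat fun ζ => by
    rw [hat_apply_multActL, M.dualData_rmul, M.χ_actR_σ]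

theorem multActL_dualδ_inv (a : A) : H.multActL (↑D.δ⁻¹) (H.S (H.S a)) = M.σ a :=
  H.eq_of_forall_hat fun ζ => by
    obtain ⟨ξ, rfl⟩ : ∃ ξ, (D.δ : Mult H.Hat).rmul ξ = ζ := ⟨_, Mult.rmul_inv_apply D.δ ζ⟩
    rw [hat_apply_multActL, Mult.rmul_apply_inv, M.dualData_rmul, M.χ_actR_σ]

theorem multActR_dualδ_inv (a : A) :
    H.multActR (H.S.symm (H.S.symm a)) (↑D.δ⁻¹) = M.σ' a :=
  H.eq_of_forall_hat fun ζ => by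
    obtain ⟨ξ, rfl⟩ : ∃ ξ, (D.δ : Mult H.Hat).lmul ξ = ζ := ⟨_, Mult.lmul_inv_apply D.δ ζ⟩
    rw [hat_apply_multActR, Mult.lmul_apply_inv, M.dualData_lmul, M.χ_actL_σ']

end ModularData

end AlgQuantumHypergroup

end

theorem proposition4p3 {A : Type*} [NonUnitalRing A] [Module ℂ A] [IsScalarTower ℂ A A]
    [SMulCommClass ℂ A A] (H : AlgQuantumHypergroup A) :
    Nonempty H.ModularData ∧ Nonempty H.DualData ∧
    ∀ (M : H.ModularData) (D : H.DualData) (a : A),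
      M.σ a = H.multActL (↑D.δ⁻¹) (H.S (H.S a)) ∧
      M.σ' a = H.multActR (H.S.symm (H.S.symm a)) (↑D.δ⁻¹) ∧
      Mult.of (H.S (H.S (H.S (H.S a)))) =
        ↑M.δ⁻¹ * Mult.of (H.multActR (H.multActL (↑D.δ) a) (↑D.δ⁻¹)) * ↑M.δ := by
  refine ⟨H.nonempty_modularData, H.nonempty_modularData.elim fun M => M.nonempty_dualData,
    fun M D a => ⟨(M.multActL_dualδ_inv D a).symm, (M.multActR_dualδ_inv D a).symm, ?_⟩⟩
  -- On `σ(a)` the inner action is simply `δ̂ ▷ σ(a) = S²(a)`.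
  obtain ⟨a, rfl⟩ := M.σ.surjective a
  -- Reading `S²(a)` as `S⁻²(S⁴(a))` makes the outer action equal to `σ'(S⁴(a))`.
  have h := M.multActR_dualδ_inv D (H.S (H.S (H.S (H.S a))))
  rw [LinearEquiv.symm_apply_apply, LinearEquiv.symm_apply_apply] at h
  rw [M.multActL_dualδ_σ, h, mul_assoc, Mult.of_mul, M.rmul_σ', Mult.mul_of, Mult.lmul_apply_inv,
    M.σ_S_S, M.σ_S_S]
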